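/- Let $M$ be a closed smooth $m$-dimensional manifold, let $(N^n,\gamma)$ be a closed Riemannian manifold, let $\kappa>0$, and let $(g(t),\phi(t))$, $t\in[0,T)$, be a smooth solution of the Ricci flow coupled with the harmonic map flow, $$\partial_t g=-2\,\mathrm{Ric}_{g}+2\kappa\,\nabla\phi\otimes\nabla\phi,\qquad \partial_t\phi=\tau_g\phi ,$$ where $\phi(t):M\to N$, $\nabla\phi\otimes\nabla\phi=\phi^*\gamma$ and $\tau_g\phi$ is the tension field. Put $\mathcal S=\mathrm{Ric}_g-\kappa\nabla\phi\otimes\nabla\phi$ and $S=R-\kappa|\nabla\phi|^2=\mathrm{tr}_g\mathcal S$; below, gradients, norms, $\mathcal S$, $S$ and the Riemannian measure $d\mu$ are those of time $t$. Let $p,q>1$ and $\alpha,\beta>0$ satisfy $\frac{\alpha+1}{p}+\frac{\beta+1}{q}=1$. A number $\Lambda$ is an eigenvalue on $(M,g)$, with normalized eigenfunctions $(u,v)\in W^{1,p}(M)\times W^{1,q}(M)$, if $\int_M|u|^\alpha|v|^\beta uv\,d\mu=1$ and $$\int_M|\nabla u|^{p-2}\langle\nabla u,\nabla f\rangle d\mu=\Lambda\int_M|u|^\alpha|v|^\beta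 v f\,d\mu,\qquad \int_M|\nabla v|^{q-2}\langle\nabla v,\nabla h\rangle d\mu=\Lambda\int_M|u|^\alpha|v|^\beta u h\,d\mu$$ for all $f\in W^{1,p}(M)$ and $h\in W^{1,q}(M)$. The first eigenvalue $\lambda(t)$ is the infimum of the positive eigenvalues on $(M,g(t))$. Let $u(t),v(t)$, $t\in[0,T)$, be functions on $M$ such that $t\mapsto u(t)$ and $t\mapsto v(t)$ are continuously differentiable maps from $[0,T)$ to $C^1(M)$ (for example, $u,v$ smooth on $[0,T)\times M$), and such that for all $t\in[0,T)$ $$\int_M|u|^\alpha|v|^\beta uv\,d\mu=1,\qquad \int_M|u|^\alpha|v|^\beta v\,d\mu=0,\qquad \int_M|u|^\alpha|v|^\beta u\,d\mu=0 .$$ Define $$\lambda(u,v,t)=\frac{\alpha+1}{p}\int_M|\nabla u|^p\,d\mu+\frac{\beta+1}{q}\int_M|\nabla v|^q\,d\mu .$$ Let $t_1\in[0,T)$, and suppose that $(u(t_1),v(t_1))$ are normalized eigenfunctions on $(M,g(t_1))$ for the eigenvalue $\Lambda$. Then $\lambda(u,v,t_1)=\Lambda$, the function $t\mapsto\lambda(u,v,t)$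 is differentiable at $t_1$ (from the right if $t_1=0$), and $$\begin{aligned}\frac{d\lambda}{dt}(u,v,t)\Big|_{t=t_1}={}&\Lambda\int_M S|u|^\alpha|v|^\beta uv\,d\mu+(\alpha+1)\int_M\mathcal S(\nabla u,\nabla u)|\nabla u|^{p-2}d\mu-\frac{\alpha+1}{p}\int_M|\nabla u|^pS\,d\mu\\&+(\beta+1)\int_M\mathcal S(\nabla v,\nabla v)|\nabla v|^{q-2}d\mu-\frac{\beta+1}{q}\int_M|\nabla v|^qS\,d\mu,\end{aligned}$$ where the right-hand side is evaluated at $t=t_1$. In particular, this holds with $\Lambda=\lambda(t_1)$ if $(u(t_1),v(t_1))$ are normalized eigenfunctions for the first eigenvalue $\lambda(t_1)$. -/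

import Mathlib

open scoped Manifold ContDiff Topology
open MeasureTheory Set

noncomputable section

namespace RHFlow

/-! ### Riemannian geometry of a boundaryless manifold modelled on `ℝᵐ` -/

/-- Smooth Riemannian metrics on the tangent bundle of `M`. -/
abbrev Metric (m : ℕ) (M : Type*) [TopologicalSpace M] [ChartedSpace (EuclideanSpace ℝ (Fin m)) M]
    [IsManifold (𝓡 m) ∞ M] : Type _ :=
  Bundle.ContMDiffRiemannianMetric (𝓡 m) ∞ (EuclideanSpace ℝ (Fin m))
    (fun x : M => TangentSpace (𝓡 m) x)

/-- The `i`-th vector of the standard basis of `ℝᵐ`. -/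
def stdVec (m : ℕ) (i : Fin m) : EuclideanSpace ℝ (Fin m) := EuclideanSpace.single i 1

section Geometry

variable {m : ℕ} {M : Type*} [TopologicalSpace M] [ChartedSpace (EuclideanSpace ℝ (Fin m)) M]

/-- The standard basis of the fibre `T_x M` (which, as a vector space, is the model space `ℝᵐ`). -/
def frameVec (x : M) (i : Fin m) : TangentSpace (𝓡 m) x := stdVec m i

/-- The coordinate vector field `∂ᵢ` of the chart at `c`, at the point with coordinates `y`. -/
def coordVec (c : M) (i : Fin m) (y : EuclideanSpace ℝ (Fin m)) :
    TangentSpace (𝓡 m) ((extChartAt (𝓡 m) c).symm y) :=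
  mfderiv 𝓘(ℝ, EuclideanSpace ℝ (Fin m)) (𝓡 m) (extChartAt (𝓡 m) c).symm y (stdVec m i)

/-- The `i`-th component of `v ∈ T_x M` in the coordinate basis of the chart at `x`. -/
def comp (x : M) (v : TangentSpace (𝓡 m) x) (i : Fin m) : ℝ :=
  (mvfderiv (𝓡 m) (extChartAt (𝓡 m) x) x v) i

/-- The partial derivative `∂ᵢ F` at `y`. -/
def pd (i : Fin m) (F : EuclideanSpace ℝ (Fin m) → ℝ) (y : EuclideanSpace ℝ (Fin m)) : ℝ :=
  fderiv ℝ F y (stdVec m i)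

/-! ### Weak differentials and evolving functions -/

/-- The field of covectors `σ` is the weak differential of `f`: in every chart its components are
the weak partial derivatives of `f`. -/
structure HasWeakDifferential (f : M → ℝ) (σ : ∀ x : M, TangentSpace (𝓡 m) x →L[ℝ] ℝ) :
    Prop where
  locInt_fun : ∀ c : M, LocallyIntegrableOn (fun y => f ((extChartAt (𝓡 m) c).symm y))
    (extChartAt (𝓡 m) c).target
  locInt_diff : ∀ (c : M) (i : Fin m),
    LocallyIntegrableOn (fun y => σ ((extChartAt (𝓡 m) c).symm y) (coordVec c i y))
      (extChartAt (𝓡 m) c).target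
  integral_eq : ∀ (c : M) (i : Fin m) (η : EuclideanSpace ℝ (Fin m) → ℝ),
    ContDiff ℝ ∞ η → HasCompactSupport η → tsupport η ⊆ (extChartAt (𝓡 m) c).target →
      ∫ y, f ((extChartAt (𝓡 m) c).symm y) * pd i η y
        = -∫ y, σ ((extChartAt (𝓡 m) c).symm y) (coordVec c i y) * η y

/-- `t ↦ u(t)` is a continuous map from `[0,T)` to `C¹(M)`: every `u(t)` is `C¹`, and `u` and its
first partial derivatives in charts are jointly continuous in time and space. -/
structure IsContC1 (m : ℕ) {M : Type*} [TopologicalSpace M]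
    [ChartedSpace (EuclideanSpace ℝ (Fin m)) M] (T : ℝ) (u : ℝ → M → ℝ) : Prop where
  contMDiff : ∀ t ∈ Ico 0 T, ContMDiff (𝓡 m) 𝓘(ℝ, ℝ) 1 (u t)
  continuous_fun : ContinuousOn (fun z : ℝ × M => u z.1 z.2) (Ico 0 T ×ˢ univ)
  continuous_diff : ∀ (c : M) (i : Fin m),
    ContinuousOn (fun z : ℝ × EuclideanSpace ℝ (Fin m) =>
      pd i (fun y => u z.1 ((extChartAt (𝓡 m) c).symm y)) z.2)
      (Ico 0 T ×ˢ (extChartAt (𝓡 m) c).target)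

/-- `t ↦ u(t)` is a continuously differentiable map from `[0,T)` to `C¹(M)`, with derivative
`u' = ∂ₜ u`; the time derivative then commutes with the differential in space. Functions that are
smooth on `[0,T) × M` have this property. -/
def IsC1Evolution (m : ℕ) {M : Type*} [TopologicalSpace M]
    [ChartedSpace (EuclideanSpace ℝ (Fin m)) M] (T : ℝ) (u : ℝ → M → ℝ) : Prop :=
  IsContC1 m T u ∧ ∃ u' : ℝ → M → ℝ, IsContC1 m T u' ∧
    (∀ t ∈ Ico 0 T, ∀ x : M, HasDerivWithinAt (fun s => u s x) (u' t x) (Ico 0 T) t) ∧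
    ∀ t ∈ Ico 0 T, ∀ (x : M) (w : TangentSpace (𝓡 m) x),
      HasDerivWithinAt (fun s => mvfderiv (𝓡 m) (u s) x w) (mvfderiv (𝓡 m) (u' t) x w)
        (Ico 0 T) t

/-! ### Metric, curvature and gradient -/

variable [IsManifold (𝓡 m) ∞ M]

/-- The matrix `g_{ij}` of the metric in the chart at `c`, as a function of the coordinates. -/
def gram (g : Metric m M) (c : M) (y : EuclideanSpace ℝ (Fin m)) : Matrix (Fin m) (Fin m) ℝ :=
  Matrix.of fun i j => g.inner ((extChartAt (𝓡 m) c).symm y) (coordVec c i y) (coordVec c j y)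

/-- The Christoffel symbol `Γᵏᵢⱼ` of the Levi-Civita connection in the chart at `c`. -/
def christoffel (g : Metric m M) (c : M) (k i j : Fin m) (y : EuclideanSpace ℝ (Fin m)) : ℝ :=
  (1 / 2) * ∑ l, (gram g c y)⁻¹ k l *
    (pd i (fun z => gram g c z j l) y + pd j (fun z => gram g c z i l) y
      - pd l (fun z => gram g c z i j) y)

/-- The components `Ric_{ij}` of the Ricci tensor in the chart at `c`
(with the sign for which round spheres have positive Ricci curvature). -/
def ricciCoord (g : Metric m M) (c : M) (i j : Fin m) (y : EuclideanSpace ℝ (Fin m)) : ℝ :=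
  ∑ k, (pd k (christoffel g c k i j) y - pd j (christoffel g c k i k) y
    + ∑ l, (christoffel g c k k l y * christoffel g c l i j y
      - christoffel g c k j l y * christoffel g c l i k y))

/-- The Ricci tensor at the point `x`. -/
def ricci (g : Metric m M) (x : M) (v w : TangentSpace (𝓡 m) x) : ℝ :=
  ∑ i, ∑ j, ricciCoord g x i j (extChartAt (𝓡 m) x x) * comp x v i * comp x w j

/-- The matrix of `g` in the standard basis of `T_x M`. -/
def frameGram (g : Metric m M) (x : M) : Matrix (Fin m) (Fin m) ℝ :=
  Matrix.of fun i j => g.inner x (frameVec x i) (frameVec x j)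

/-- The trace, with respect to `g`, of a bilinear form on `T_x M`. -/
def metricTrace (g : Metric m M) (x : M)
    (B : TangentSpace (𝓡 m) x → TangentSpace (𝓡 m) x → ℝ) : ℝ :=
  ∑ i, ∑ j, (frameGram g x)⁻¹ i j * B (frameVec x i) (frameVec x j)

/-- The tangent vector dual to a covector `σ` on `T_x M`; for `σ = df` it is the gradient of `f`. -/
def sharp (g : Metric m M) (x : M) (σ : TangentSpace (𝓡 m) x →L[ℝ] ℝ) : TangentSpace (𝓡 m) x :=
  ∑ i, (∑ j, (frameGram g x)⁻¹ i j * σ (frameVec x j)) • frameVec x i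

/-- The norm of `sharp g x σ`; for `σ = df` it is `|∇f|`. -/
def gradNorm (g : Metric m M) (x : M) (σ : TangentSpace (𝓡 m) x →L[ℝ] ℝ) : ℝ :=
  Real.sqrt (g.inner x (sharp g x σ) (sharp g x σ))

/-! ### The Riemannian measure -/

variable (m M) in
/-- A smooth partition of unity subordinate to the chart domains. It depends on `M` only. -/
def chartPartition [CompactSpace M] [T2Space M] : SmoothPartitionOfUnity M (𝓡 m) M univ :=
  Classical.choose (SmoothPartitionOfUnity.exists_isSubordinate_chartAt_source (𝓡 m) M)

/-- The Riemannian measure `dμ`: on functions,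
`∫ f dμ = ∑_c ∫ (ρ_c f)(y) √(det g_{ij}(y)) dy`, where the `c`-th integral is taken in the chart
at `c` and `(ρ_c)` is a partition of unity subordinate to the charts. -/
def volMeasure [CompactSpace M] [T2Space M] [MeasurableSpace M] (g : Metric m M) : Measure M :=
  Measure.sum fun c : M =>
    ((volume.restrict (extChartAt (𝓡 m) c).target).withDensity fun y =>
      ENNReal.ofReal (chartPartition m M c ((extChartAt (𝓡 m) c).symm y)
        * Real.sqrt (gram g c y).det)).map (extChartAt (𝓡 m) c).symm

/-! ### The flow -/

section Flow

variable {n : ℕ} {N : Type*} [TopologicalSpace N] [ChartedSpace (EuclideanSpace ℝ (Fin n)) N]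
  [IsManifold (𝓡 n) ∞ N]

/-- `∇φ ⊗ ∇φ`, that is, the pull-back of the metric `γ` of the target under `φ`. -/
def pullback (γ : Metric n N) (φ : M → N) (x : M) (v w : TangentSpace (𝓡 m) x) : ℝ :=
  γ.inner (φ x) (mfderiv (𝓡 m) (𝓡 n) φ x v) (mfderiv (𝓡 m) (𝓡 n) φ x w)

/-- The tensor `𝒮 = Ric - κ ∇φ ⊗ ∇φ`. -/
def tensorS (κ : ℝ) (g : Metric m M) (γ : Metric n N) (φ : M → N) (x : M)
    (v w : TangentSpace (𝓡 m) x) : ℝ :=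
  ricci g x v w - κ * pullback γ φ x v w

/-- The function `S = R - κ |∇φ|²`, where `R` is the scalar curvature of `g`. -/
def scalarS (κ : ℝ) (g : Metric m M) (γ : Metric n N) (φ : M → N) (x : M) : ℝ :=
  metricTrace g x (ricci g x) - κ * metricTrace g x (pullback γ φ x)

/-- The `k`-th component of `φ` in the charts at `x` and at `φ x`. -/
def mapCoord (φ : M → N) (x : M) (k : Fin n) (y : EuclideanSpace ℝ (Fin m)) : ℝ :=
  (extChartAt (𝓡 n) (φ x) (φ ((extChartAt (𝓡 m) x).symm y)) : EuclideanSpace ℝ (Fin n)) k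

/-- The components, in the chart of the target at `φ x`, of the tension field of
`φ : (M, g) → (N, γ)` at `x`:
`gⁱʲ (∂ᵢ∂ⱼφᵏ - Γˡᵢⱼ ∂ₗφᵏ + Γ̃ᵏₐᵦ(φ) ∂ᵢφᵃ ∂ⱼφᵇ)`. -/
def tension (g : Metric m M) (γ : Metric n N) (φ : M → N) (x : M) : EuclideanSpace ℝ (Fin n) :=
  let y := extChartAt (𝓡 m) x x
  WithLp.toLp 2 fun k => ∑ i, ∑ j, (gram g x y)⁻¹ i j *
    (pd i (pd j (mapCoord φ x k)) y
      - ∑ l, christoffel g x l i j y * pd l (mapCoord φ x k) y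
      + ∑ a, ∑ b, christoffel γ (φ x) k a b (extChartAt (𝓡 n) (φ x) (φ x)) *
          pd i (mapCoord φ x a) y * pd j (mapCoord φ x b) y)

/-- `(g(t), φ(t))`, `0 ≤ t < T`, is a smooth solution of the Ricci flow coupled with the harmonic
map flow, `∂ₜ g = -2 Ric + 2 κ ∇φ ⊗ ∇φ`, `∂ₜ φ = τ_g φ`, with coupling constant `κ`. At `t = 0`
the time derivatives are one-sided. -/
structure IsSolution (κ T : ℝ) (γ : Metric n N) (g : ℝ → Metric m M) (φ : ℝ → M → N) : Prop where
  smooth_metric : ∀ (c : M) (i j : Fin m),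
    ContDiffOn ℝ ∞ (fun z : ℝ × EuclideanSpace ℝ (Fin m) => gram (g z.1) c z.2 i j)
      (Ico 0 T ×ˢ (extChartAt (𝓡 m) c).target)
  smooth_map : ContMDiffOn (𝓘(ℝ, ℝ).prod (𝓡 m)) (𝓡 n) ∞ (fun z : ℝ × M => φ z.1 z.2)
    (Ico 0 T ×ˢ univ)
  metric_eq : ∀ t ∈ Ico 0 T, ∀ (x : M) (v w : TangentSpace (𝓡 m) x),
    HasDerivWithinAt (fun s => (g s).inner x v w)
      (-2 * ricci (g t) x v w + 2 * κ * pullback γ (φ t) x v w) (Ico 0 T) t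
  map_eq : ∀ t ∈ Ico 0 T, ∀ x : M,
    HasDerivWithinAt
      (fun s => (extChartAt (𝓡 n) (φ t x) (φ s x) : EuclideanSpace ℝ (Fin n)))
      (tension (g t) γ (φ t) x) (Ico 0 T) t

end Flow

/-! ### Sobolev functions and eigenvalues -/

variable [CompactSpace M] [T2Space M] [MeasurableSpace M]

/-- `f ∈ W^{1,r}(M)` with weak differential `σ`. -/
structure MemSobolev (g : Metric m M) (r : ℝ) (f : M → ℝ)
    (σ : ∀ x : M, TangentSpace (𝓡 m) x →L[ℝ] ℝ) : Prop where
  memLp_fun : MemLp f (ENNReal.ofReal r) (volMeasure g)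
  memLp_grad : MemLp (fun x => gradNorm g x (σ x)) (ENNReal.ofReal r) (volMeasure g)
  weak : HasWeakDifferential f σ

/-- `B(u,v) = ∫ |u|^α |v|^β u v dμ`. -/
def funB (g : Metric m M) (α β : ℝ) (u v : M → ℝ) : ℝ :=
  ∫ x, |u x| ^ α * |v x| ^ β * u x * v x ∂(volMeasure g)

/-- `A(u,v) = (α+1)/p ∫ |∇u|^p dμ + (β+1)/q ∫ |∇v|^q dμ`, for continuously differentiable `u`, `v`.
With `u`, `v` and `g` depending on `t`, this is the eigenvalue function `λ(u,v,t)`. -/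
def funA (g : Metric m M) (p q α β : ℝ) (u v : M → ℝ) : ℝ :=
  (α + 1) / p * ∫ x, gradNorm g x (mvfderiv (𝓡 m) u x) ^ p ∂(volMeasure g)
    + (β + 1) / q * ∫ x, gradNorm g x (mvfderiv (𝓡 m) v x) ^ q ∂(volMeasure g)

/-- `(u,v) ∈ W^{1,p}(M) × W^{1,q}(M)`, with weak differentials `σ`, `θ`, is a pair of eigenfunctions
with eigenvalue `Λ` of the system `Δ_p u = -Λ |u|^α |v|^β v`, `Δ_q v = -Λ |u|^α |v|^β u`, understood
weakly, and is normalized by `B(u,v) = 1`. The normalization excludes the trivial solutions `u = 0`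
or `v = 0` with the other function constant, which exist for every `Λ`. -/
structure IsEigenpair (g : Metric m M) (p q α β Λ : ℝ)
    (u : M → ℝ) (σ : ∀ x : M, TangentSpace (𝓡 m) x →L[ℝ] ℝ)
    (v : M → ℝ) (θ : ∀ x : M, TangentSpace (𝓡 m) x →L[ℝ] ℝ) : Prop where
  mem_u : MemSobolev g p u σ
  mem_v : MemSobolev g q v θ
  normalized : funB g α β u v = 1
  eq_u : ∀ (f : M → ℝ) (ζ : ∀ x : M, TangentSpace (𝓡 m) x →L[ℝ] ℝ), MemSobolev g p f ζ →
    ∫ x, gradNorm g x (σ x) ^ (p - 2) * g.inner x (sharp g x (σ x)) (sharp g x (ζ x))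
        ∂(volMeasure g)
      = Λ * ∫ x, |u x| ^ α * |v x| ^ β * v x * f x ∂(volMeasure g)
  eq_v : ∀ (f : M → ℝ) (ζ : ∀ x : M, TangentSpace (𝓡 m) x →L[ℝ] ℝ), MemSobolev g q f ζ →
    ∫ x, gradNorm g x (θ x) ^ (q - 2) * g.inner x (sharp g x (θ x)) (sharp g x (ζ x))
        ∂(volMeasure g)
      = Λ * ∫ x, |u x| ^ α * |v x| ^ β * u x * f x ∂(volMeasure g)

/-- `Λ` is an eigenvalue of the system on `(M, g)`. -/
def IsEigenvalue (g : Metric m M) (p q α β Λ : ℝ) : Prop :=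
  ∃ u σ v θ, IsEigenpair g p q α β Λ u σ v θ

/-- The first (positive) eigenvalue of the system on `(M, g)`. -/
def firstEigenvalue (g : Metric m M) (p q α β : ℝ) : ℝ :=
  sInf {Λ : ℝ | 0 < Λ ∧ IsEigenvalue g p q α β Λ}

/-- The evolving pairs `(u(t), v(t))`, `0 ≤ t < T`, on which the eigenvalue function `λ(u,v,t)` is
considered. -/
structure IsNormalizedEvolution (T α β : ℝ) (g : ℝ → Metric m M) (u v : ℝ → M → ℝ) : Prop where
  evol_u : IsC1Evolution m T u
  evol_v : IsC1Evolution m T v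
  normalized : ∀ t ∈ Ico 0 T, funB (g t) α β (u t) (v t) = 1
  orth_u : ∀ t ∈ Ico 0 T, ∫ x, |u t x| ^ α * |v t x| ^ β * v t x ∂(volMeasure (g t)) = 0
  orth_v : ∀ t ∈ Ico 0 T, ∫ x, |u t x| ^ α * |v t x| ^ β * u t x ∂(volMeasure (g t)) = 0

/-- The right-hand side of the variation formula, for an eigenvalue `Λ`. -/
def variationRHS {n : ℕ} {N : Type*} [TopologicalSpace N]
    [ChartedSpace (EuclideanSpace ℝ (Fin n)) N] [IsManifold (𝓡 n) ∞ N]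
    (κ p q α β Λ : ℝ) (g : Metric m M) (γ : Metric n N) (φ : M → N) (u v : M → ℝ) : ℝ :=
  Λ * ∫ x, scalarS κ g γ φ x * (|u x| ^ α * |v x| ^ β * u x * v x) ∂(volMeasure g)
    + (α + 1) * ∫ x, tensorS κ g γ φ x (sharp g x (mvfderiv (𝓡 m) u x))
        (sharp g x (mvfderiv (𝓡 m) u x)) * gradNorm g x (mvfderiv (𝓡 m) u x) ^ (p - 2)
        ∂(volMeasure g)
    - (α + 1) / p * ∫ x, gradNorm g x (mvfderiv (𝓡 m) u x) ^ p * scalarS κ g γ φ x ∂(volMeasure g)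
    + (β + 1) * ∫ x, tensorS κ g γ φ x (sharp g x (mvfderiv (𝓡 m) v x))
        (sharp g x (mvfderiv (𝓡 m) v x)) * gradNorm g x (mvfderiv (𝓡 m) v x) ^ (q - 2)
        ∂(volMeasure g)
    - (β + 1) / q * ∫ x, gradNorm g x (mvfderiv (𝓡 m) v x) ^ q * scalarS κ g γ φ x ∂(volMeasure g)

end Geometry

end RHFlow

end

/-!
The flow equation says that `∂ₜ g = -2 𝒮`. Hence `𝒮` is continuous in time and space, being the time
derivative of a smooth family of metrics, and no coordinate computation with the Ricci tensor or the
tension field is needed. From `∂ₜ g = -2 𝒮` one reads off `∂ₜ dμ = -S dμ`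
(`hasDerivWithinAt_volRatio`, by Jacobi's formula) and
`∂ₜ |∇u|² = 2 𝒮(∇u,∇u) + 2 ⟨∇u,∇∂ₜu⟩` (`hasDerivWithinAt_gradInner_rpow`, from the derivative of the
inverse matrix). Differentiating `∫ |∇u|^p dμ` under the integral sign gives
`p ∫ |∇u|^(p-2) 𝒮(∇u,∇u) + p ∫ |∇u|^(p-2) ⟨∇u,∇∂ₜu⟩ - ∫ |∇u|^p S`
(`hasDerivWithinAt_integral_gradNorm_rpow`). At `t₁` the middle term is
`p Λ ∫ |u|^α |v|^β v ∂ₜu` by the eigenvalue equation tested with `∂ₜu`. Weighted by `(α+1)/p` and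
`(β+1)/q`, the two terms of this kind, for `u` and for `v`, add up to `Λ ∫ S |u|^α |v|^β u v`, because
the derivative of the constant `B(u,v) = 1` vanishes (`hasDerivWithinAt_funB`). Testing the equations
with `u` and `v` themselves gives `λ(u,v,t₁) = Λ` (`IsEigenpair.funA_eq`).

For differentiation under the integral sign all integrals are taken against the fixed finite measure
of time `t₁`, with the density `volRatio (g t₁) (g t)` (`volMeasure_eq_withDensity`); one-sided
derivatives at `t = 0` are covered by working within `[0,T)`. Time derivatives are computed at a
fixed point `x` in the basis `frameVec x`; this basis need not depend continuously on `x`, so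
continuity in `(t,x)` is checked in the coordinate bases of charts, and the change of basis is linear
algebra. Since only `p > 1` is assumed, `|∇u|^p` need not be a differentiable function of `|∇u|²` at
zeros of `∇u`: there it is differentiable in time because `|∇u|²` vanishes to second order
(`hasDerivWithinAt_quadratic_rpow`), and the derivative stays bounded because
`|𝒮(∇u,∇u)| ≤ C |∇u|²` locally (`eventually_abs_tensorS_sharp_le`).
-/

open scoped Manifold ContDiff Topology
open MeasureTheory Set

noncomputable section

namespace RHFlow

open scoped Matrix

/-! ### Calculus -/

section Calculus

open Filter Asymptotics

/-- **Jacobi's formula** for the derivative of a determinant. -/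
theorem hasDerivWithinAt_det {m : ℕ} {A : ℝ → Matrix (Fin m) (Fin m) ℝ}
    {A' : Matrix (Fin m) (Fin m) ℝ} {s : Set ℝ} {t : ℝ}
    (h : ∀ i j, HasDerivWithinAt (fun r => A r i j) (A' i j) s t) :
    HasDerivWithinAt (fun r => (A r).det) ((A t).adjugate * A').trace s t := by
  have h1 : HasDerivWithinAt (fun r => (A r).det)
      (∑ σ : Equiv.Perm (Fin m), (Equiv.Perm.sign σ : ℝ) *
        ∑ i, (∏ j ∈ Finset.univ.erase i, A t (σ j) j) • A' (σ i) i) s t := by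
    simp only [Matrix.det_apply']
    refine HasDerivWithinAt.fun_sum fun σ _ => HasDerivWithinAt.const_mul _ ?_
    exact HasDerivWithinAt.fun_finsetProd fun i _ => h (σ i) i
  convert h1 using 1
  have h2 : ∀ i, ((A t).adjugate * A') i i
      = ∑ σ : Equiv.Perm (Fin m), (Equiv.Perm.sign σ : ℝ) *
        ((∏ j ∈ Finset.univ.erase i, A t (σ j) j) * A' (σ i) i) := by
    intro i
    have : ((A t).adjugate * A') i i = ((A t).updateCol i fun k => A' k i).det := by
      rw [← Matrix.cramer_apply, Matrix.cramer_eq_adjugate_mulVec]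
      rfl
    rw [this, Matrix.det_apply']
    refine Finset.sum_congr rfl fun σ _ => ?_
    rw [← Finset.mul_prod_erase _ _ (Finset.mem_univ i), Matrix.updateCol_self, mul_comm (A' _ _)]
    congr 2
    refine Finset.prod_congr rfl fun j hj => ?_
    rw [Matrix.updateCol_ne (Finset.ne_of_mem_erase hj)]
  simp only [Matrix.trace, Matrix.diag_apply, h2, smul_eq_mul, Finset.mul_sum]
  exact Finset.sum_comm

theorem continuousOn_matrix_inv {X : Type*} [TopologicalSpace X] {m : ℕ}
    {A : X → Matrix (Fin m) (Fin m) ℝ} {s : Set X}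
    (h : ∀ i j, ContinuousOn (fun r => A r i j) s) (hA : ∀ r ∈ s, (A r).det ≠ 0) (i j : Fin m) :
    ContinuousOn (fun r => (A r)⁻¹ i j) s := by
  have hc : ContinuousOn A s := continuousOn_pi.2 fun i => continuousOn_pi.2 fun j => h i j
  have hd : ContinuousOn (fun r => (A r).det) s := by
    rw [continuousOn_iff_continuous_domRestrict] at hc ⊢
    exact hc.matrix_det
  have ha : ContinuousOn (fun r => (A r).adjugate) s := by
    rw [continuousOn_iff_continuous_domRestrict] at hc ⊢
    exact hc.matrix_adjugate
  have ha' : ContinuousOn (fun r => (A r).adjugate i j) s :=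
    continuousOn_pi.1 (continuousOn_pi.1 ha i) j
  refine ((hd.inv₀ hA).mul ha').congr fun r _ => ?_
  simp [Matrix.inv_def]

/-- The derivative of the entries of an inverse matrix. -/
theorem hasDerivWithinAt_matrix_inv {m : ℕ} {A : ℝ → Matrix (Fin m) (Fin m) ℝ}
    {A' : Matrix (Fin m) (Fin m) ℝ} {s : Set ℝ} {t : ℝ} (ht : t ∈ s)
    (hc : ∀ i j, ContinuousOn (fun r => A r i j) s) (hA : ∀ r ∈ s, (A r).det ≠ 0)
    (h : ∀ i j, HasDerivWithinAt (fun r => A r i j) (A' i j) s t) (i j : Fin m) :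
    HasDerivWithinAt (fun r => (A r)⁻¹ i j) (-((A t)⁻¹ * A' * (A t)⁻¹) i j) s t := by
  rw [hasDerivWithinAt_iff_tendsto_slope]
  have key : ∀ r ∈ s, slope (fun r => (A r)⁻¹ i j) t r
      = -∑ l, (∑ k, (A r)⁻¹ i k * slope (fun r => A r k l) t r) * (A t)⁻¹ l j := by
    intro r hr
    -- the resolvent identity `B⁻¹ - A⁻¹ = -B⁻¹ (B - A) A⁻¹`
    have h1 : (A r)⁻¹ - (A t)⁻¹ = -((A r)⁻¹ * (A r - A t) * (A t)⁻¹) := by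
      rw [mul_sub, sub_mul, Matrix.nonsing_inv_mul _ (hA r hr).isUnit, mul_assoc,
        Matrix.mul_nonsing_inv _ (hA t ht).isUnit]
      simp
    have h2 := congrFun (congrFun h1 i) j
    simp only [Matrix.sub_apply, Matrix.neg_apply] at h2
    rw [slope_def_field, h2, Matrix.mul_apply, neg_div, Finset.sum_div]
    congr 1
    refine Finset.sum_congr rfl fun l _ => ?_
    rw [Matrix.mul_apply, mul_div_right_comm, Finset.sum_div]
    congr 1
    refine Finset.sum_congr rfl fun k _ => ?_
    rw [slope_def_field, Matrix.sub_apply, mul_div_assoc]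
  have hlim : Tendsto
      (fun r => -∑ l, (∑ k, (A r)⁻¹ i k * slope (fun r => A r k l) t r) * (A t)⁻¹ l j)
      (𝓝[s \ {t}] t) (𝓝 (-∑ l, (∑ k, (A t)⁻¹ i k * A' k l) * (A t)⁻¹ l j)) := by
    refine (tendsto_finsetSum _ fun l _ => ?_).neg
    refine (tendsto_finsetSum _ fun k _ => ?_).mul_const _
    refine Tendsto.mul ?_ (hasDerivWithinAt_iff_tendsto_slope.1 (h k l))
    exact (continuousOn_matrix_inv hc hA i k t ht).mono_left (nhdsWithin_mono _ sdiff_subset)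
  have hval : -((A t)⁻¹ * A' * (A t)⁻¹) i j
      = -∑ l, (∑ k, (A t)⁻¹ i k * A' k l) * (A t)⁻¹ l j := by
    simp only [Matrix.mul_apply]
  rw [hval]
  refine hlim.congr' ?_
  filter_upwards [self_mem_nhdsWithin] with r hr using (key r hr.1).symm

/-- A nonnegative function vanishing to second order at `t` has a power of exponent `> 1/2` with
vanishing derivative. -/
theorem hasDerivWithinAt_rpow_of_isBigO_sq {f : ℝ → ℝ} {s : Set ℝ} {t r : ℝ} (hr : 1 / 2 < r)
    (h0 : f t = 0) (hO : f =O[𝓝[s] t] fun x => (x - t) ^ 2) :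
    HasDerivWithinAt (fun x => f x ^ r) 0 s t := by
  have hr0 : 0 < r := by linarith
  rw [hasDerivWithinAt_iff_isLittleO]
  simp only [h0, Real.zero_rpow hr0.ne', sub_zero, smul_zero]
  have h1 : (fun x => f x ^ r) =O[𝓝[s] t] fun x => ((x - t) ^ 2) ^ r :=
    hO.rpow hr0.le (Eventually.of_forall fun x => sq_nonneg _)
  have h2 : (fun x : ℝ => ((x - t) ^ 2) ^ r) = fun x => |x - t| ^ (2 * r - 1) * |x - t| := by
    funext x
    rcases eq_or_ne (x - t) 0 with h | h
    · rw [h]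
      simp [Real.zero_rpow hr0.ne']
    · rw [← sq_abs, ← Real.rpow_natCast, ← Real.rpow_mul (abs_nonneg _)]
      nth_rewrite 3 [← Real.rpow_one |x - t|]
      rw [← Real.rpow_add (abs_pos.2 h)]
      congr 1
      push_cast
      ring
  have h3 : (fun x : ℝ => |x - t| ^ (2 * r - 1)) =o[𝓝[s] t] fun _ => (1 : ℝ) := by
    rw [isLittleO_one_iff]
    have : ContinuousAt (fun x : ℝ => |x - t| ^ (2 * r - 1)) t :=
      ContinuousAt.rpow_const (by fun_prop) (Or.inr (by linarith))
    have h4 := this.tendsto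
    simp only [sub_self, abs_zero] at h4
    rw [Real.zero_rpow (by linarith)] at h4
    exact h4.mono_left nhdsWithin_le_nhds
  rw [h2] at h1
  refine h1.trans_isLittleO ?_
  have h5 : (fun x : ℝ => |x - t|) =O[𝓝[s] t] fun x => x - t :=
    (isBigO_refl (fun x : ℝ => x - t) _).abs_left
  simpa using h3.mul_isBigO h5

/-- Powers of a time-dependent quadratic form are differentiable, even where the vector vanishes,
as long as the exponent exceeds `1/2`. -/
theorem hasDerivWithinAt_quadratic_rpow {m : ℕ} {B : ℝ → Fin m → Fin m → ℝ}
    {B' : Fin m → Fin m → ℝ} {ξ : ℝ → Fin m → ℝ} {ξ' : Fin m → ℝ} {s : Set ℝ} {t r : ℝ}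
    (hr : 1 / 2 < r)
    (hB : ∀ i j, HasDerivWithinAt (fun x => B x i j) (B' i j) s t)
    (hξ : ∀ i, HasDerivWithinAt (fun x => ξ x i) (ξ' i) s t)
    (hdef : (∑ i, ∑ j, B t i j * ξ t i * ξ t j = 0) → ∀ i, ξ t i = 0) :
    HasDerivWithinAt (fun x => (∑ i, ∑ j, B x i j * ξ x i * ξ x j) ^ r)
      ((∑ i, ∑ j, (B' i j * ξ t i * ξ t j + B t i j * ξ' i * ξ t j + B t i j * ξ t i * ξ' j))
        * r * (∑ i, ∑ j, B t i j * ξ t i * ξ t j) ^ (r - 1)) s t := by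
  have hQ : HasDerivWithinAt (fun x => ∑ i, ∑ j, B x i j * ξ x i * ξ x j)
      (∑ i, ∑ j, (B' i j * ξ t i * ξ t j + B t i j * ξ' i * ξ t j + B t i j * ξ t i * ξ' j))
      s t := by
    refine HasDerivWithinAt.fun_sum fun i _ => HasDerivWithinAt.fun_sum fun j _ => ?_
    refine (((hB i j).fun_mul (hξ i)).fun_mul (hξ j)).congr_deriv ?_
    ring
  by_cases h0 : ∑ i, ∑ j, B t i j * ξ t i * ξ t j = 0
  -- here `ξ t = 0`, so the form vanishes to second order at `t`
  · have hz := hdef h0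
    have hd : (∑ i, ∑ j, (B' i j * ξ t i * ξ t j + B t i j * ξ' i * ξ t j
        + B t i j * ξ t i * ξ' j)) = 0 := by simp [hz]
    rw [hd, zero_mul, zero_mul]
    refine hasDerivWithinAt_rpow_of_isBigO_sq hr h0 ?_
    have hBO : ∀ i j, (fun x => B x i j) =O[𝓝[s] t] fun _ => (1 : ℝ) :=
      fun i j => (hB i j).continuousWithinAt.tendsto.isBigO_one ℝ
    have hξO : ∀ i, (fun x => ξ x i) =O[𝓝[s] t] fun x => x - t := by
      intro i
      have := (hξ i).hasFDerivWithinAt.isBigO_sub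
      simpa [hz i] using this
    refine IsBigO.fun_sum fun i _ => IsBigO.fun_sum fun j _ => ?_
    have := ((hBO i j).mul (hξO i)).mul (hξO j)
    simpa [sq] using this
  · exact hQ.rpow_const (Or.inl h0)

theorem hasDerivAt_abs_rpow_mul_self {a : ℝ} (ha : 0 < a) (x : ℝ) :
    HasDerivAt (fun y => |y| ^ a * y) ((a + 1) * |x| ^ a) x := by
  rcases eq_or_ne x 0 with rfl | hx
  · rw [abs_zero, Real.zero_rpow ha.ne', mul_zero, hasDerivAt_iff_isLittleO]
    simp only [mul_zero, sub_zero, smul_zero]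
    have h3 : (fun y : ℝ => |y| ^ a) =o[𝓝 0] fun _ => (1 : ℝ) := by
      rw [isLittleO_one_iff]
      have : ContinuousAt (fun y : ℝ => |y| ^ a) 0 :=
        ContinuousAt.rpow_const (by fun_prop) (Or.inr ha.le)
      have h4 := this.tendsto
      simpa [Real.zero_rpow ha.ne'] using h4
    simpa using h3.mul_isBigO (isBigO_refl (fun y : ℝ => y) _)
  · have hd : HasDerivAt (fun y : ℝ => |y|) (SignType.sign x : ℝ) x := hasDerivAt_abs hx
    have h1 := (hd.rpow_const (p := a) (Or.inl (abs_ne_zero.2 hx))).mul (hasDerivAt_id x)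
    refine h1.congr_deriv ?_
    have h2 : (SignType.sign x : ℝ) * x = |x| := by
      rw [mul_comm]; exact self_mul_sign x
    have h3 : |x| ^ (a - 1) * |x| = |x| ^ a := by
      nth_rewrite 2 [← Real.rpow_one |x|]
      rw [← Real.rpow_add (abs_pos.2 hx)]
      congr 1
      ring
    simp only [mul_one, id]
    linear_combination (a * |x| ^ (a - 1)) * h2 + a * h3

/-- Differentiation under the integral sign, for derivatives within a convex set and a uniform bound
of the derivative. -/
theorem hasDerivWithinAt_integral_of_bound {X : Type*} [MeasurableSpace X] {μ : Measure X}
    [IsFiniteMeasure μ] {F F' : ℝ → X → ℝ} {s : Set ℝ} {t C : ℝ} (hs : Convex ℝ s) (ht : t ∈ s)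
    (hF : ∀ r ∈ s, Integrable (F r) μ)
    (hd : ∀ r ∈ s, ∀ x, HasDerivWithinAt (fun r => F r x) (F' r x) s r)
    (hC : ∀ r ∈ s, ∀ x, |F' r x| ≤ C) :
    HasDerivWithinAt (fun r => ∫ x, F r x ∂μ) (∫ x, F' t x ∂μ) s t := by
  rw [hasDerivWithinAt_iff_tendsto_slope]
  have h1 : Tendsto (fun r => ∫ x, slope (fun r => F r x) t r ∂μ) (𝓝[s \ {t}] t)
      (𝓝 (∫ x, F' t x ∂μ)) := by
    refine tendsto_integral_filter_of_dominated_convergence (fun _ => C) ?_ ?_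
      (integrable_const _) ?_
    · filter_upwards [self_mem_nhdsWithin] with r hr
      simp only [slope_def_field]
      exact (((hF r hr.1).sub (hF t ht)).div_const _).aestronglyMeasurable
    · filter_upwards [self_mem_nhdsWithin] with r hr
      refine Eventually.of_forall fun x => ?_
      have := hs.norm_image_sub_le_of_norm_hasDerivWithin_le (fun r hr => hd r hr x)
        (fun r hr => hC r hr x) ht hr.1
      have hne : r - t ≠ 0 := sub_ne_zero.2 fun h => hr.2 h
      rw [slope_def_field, norm_div, div_le_iff₀ (norm_pos_iff.2 hne)]
      exact this
    · exact Eventually.of_forall fun x => hasDerivWithinAt_iff_tendsto_slope.1 (hd t ht x)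
  refine h1.congr' ?_
  filter_upwards [self_mem_nhdsWithin] with r hr
  simp only [slope_def_field]
  rw [integral_div, integral_sub (hF r hr.1) (hF t ht)]

/-- A function that is locally bounded on a compact set is bounded there. -/
theorem exists_bound_of_locally_bounded {X : Type*} [TopologicalSpace X] {K : Set X}
    (hK : IsCompact K) {F : X → ℝ} (h : ∀ x ∈ K, ∃ C, ∀ᶠ y in 𝓝[K] x, F y ≤ C) :
    ∃ C, ∀ y ∈ K, F y ≤ C := by
  refine hK.induction_on (p := fun S => ∃ C, ∀ y ∈ S, F y ≤ C) ⟨0, by simp⟩ ?_ ?_ ?_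
  · rintro S S' hS ⟨C, hC⟩
    exact ⟨C, fun y hy => hC y (hS hy)⟩
  · rintro S S' ⟨C, hC⟩ ⟨C', hC'⟩
    refine ⟨max C C', fun y hy => ?_⟩
    rcases hy with hy | hy
    · exact (hC y hy).trans (le_max_left _ _)
    · exact (hC' y hy).trans (le_max_right _ _)
  · intro x hx
    obtain ⟨C, hC⟩ := h x hx
    exact ⟨_, hC, C, fun y hy => hy⟩

end Calculus

/-! ### Bilinear forms and bases -/

section LinearAlgebra

open LinearMap LinearMap.BilinForm Module

variable {V : Type*} [AddCommGroup V] [Module ℝ V] {m : ℕ}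

/-- A symmetric positive definite bilinear form. It is used for the metric on a tangent space, which
carries no inner product instance, and in arbitrary bases. -/
structure IsInner (g : LinearMap.BilinForm ℝ V) : Prop where
  symm : ∀ v w, g v w = g w v
  pos : ∀ v, v ≠ 0 → 0 < g v v

namespace IsInner

variable {g : LinearMap.BilinForm ℝ V} (hg : IsInner g) (b : Basis (Fin m) ℝ V)

include hg

theorem nonneg (v : V) : 0 ≤ g v v := by
  rcases eq_or_ne v 0 with rfl | h
  · simp
  · exact (hg.pos v h).le

theorem apply_sq_le (v w : V) : g v w ^ 2 ≤ g v v * g w w :=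
  LinearMap.BilinForm.apply_sq_le_of_symm g hg.nonneg ⟨fun v w => hg.symm v w⟩ v w

theorem posDef : (toMatrix b g).PosDef := by
  refine Matrix.PosDef.of_dotProduct_mulVec_pos ?_ fun x hx => ?_
  · ext i j
    simp [hg.symm (b i)]
  · rw [star_trivial, dotProduct_toMatrix_mulVec]
    exact hg.pos _ fun h => hx ((LinearEquiv.map_eq_zero_iff _).1 h)

theorem det_pos : 0 < (toMatrix b g).det := (hg.posDef b).det_pos

theorem inv_transpose : ((toMatrix b g)⁻¹)ᵀ = (toMatrix b g)⁻¹ := by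
  simpa [Matrix.IsHermitian] using (hg.posDef b).isHermitian.inv

/-- The coordinates, in an arbitrary basis, of the vector that represents a functional. -/
theorem eq_of_dual {σ : V → ℝ} {w : V} (hw : ∀ v, g w v = σ v) :
    w = b.equivFun.symm ((toMatrix b g)⁻¹ *ᵥ fun i => σ (b i)) := by
  have h1 : (fun i => σ (b i)) = toMatrix b g *ᵥ b.equivFun w := by
    funext i
    rw [← hw, hg.symm, Matrix.mulVec, dotProduct]
    conv_lhs => rw [← b.sum_equivFun w]
    rw [map_sum]
    refine Finset.sum_congr rfl fun j _ => ?_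
    rw [map_smul, smul_eq_mul, mul_comm, LinearMap.BilinForm.toMatrix_apply]
  rw [h1, Matrix.mulVec_mulVec, Matrix.nonsing_inv_mul _ (hg.det_pos b).ne'.isUnit,
    Matrix.one_mulVec, LinearEquiv.symm_apply_apply]

/-- The value of a bilinear form on the vectors dual to two functionals. -/
theorem apply_dual_dual (S : LinearMap.BilinForm ℝ V) {σ ζ : V → ℝ} {w z : V}
    (hw : ∀ v, g w v = σ v) (hz : ∀ v, g z v = ζ v) :
    S w z = ∑ i, ∑ j, ((toMatrix b g)⁻¹ * toMatrix b S * (toMatrix b g)⁻¹) i j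
      * σ (b i) * ζ (b j) := by
  have h : ∀ (A : Matrix (Fin m) (Fin m) ℝ) (ξ η : Fin m → ℝ),
      ξ ⬝ᵥ A *ᵥ η = ∑ i, ∑ j, A i j * ξ i * η j := by
    intro A ξ η
    simp only [dotProduct, Matrix.mulVec, Finset.mul_sum]
    exact Finset.sum_congr rfl fun i _ => Finset.sum_congr rfl fun j _ => by ring
  rw [hg.eq_of_dual b hw, hg.eq_of_dual b hz, ← dotProduct_toMatrix_mulVec, ← h,
    Matrix.mulVec_mulVec]
  nth_rewrite 1 [← hg.inv_transpose b]
  rw [Matrix.mulVec_transpose, ← Matrix.dotProduct_mulVec, Matrix.mulVec_mulVec, mul_assoc]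

/-- The inner product of the vectors dual to two functionals. -/
theorem inner_dual_dual {σ ζ : V → ℝ} {w z : V}
    (hw : ∀ v, g w v = σ v) (hz : ∀ v, g z v = ζ v) :
    g w z = ∑ i, ∑ j, (toMatrix b g)⁻¹ i j * σ (b i) * ζ (b j) := by
  rw [hg.apply_dual_dual b g hw hz, Matrix.nonsing_inv_mul _ (hg.det_pos b).ne'.isUnit, one_mul]

theorem sum_inv_mul_eq_trace (S : LinearMap.BilinForm ℝ V) :
    ∑ i, ∑ j, (toMatrix b g)⁻¹ i j * S (b i) (b j) = ((toMatrix b g)⁻¹ * toMatrix b S).trace := by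
  conv_rhs => rw [← hg.inv_transpose b]
  simp only [Matrix.trace, Matrix.diag_apply, Matrix.mul_apply, LinearMap.BilinForm.toMatrix_apply,
    Matrix.transpose_apply]
  exact Finset.sum_comm

/-- A bound of `S(w,w)` by a multiple of `g(w,w)`, with a constant that depends continuously on the
matrices of `g` and `S`. -/
theorem abs_apply_dual_le (S : LinearMap.BilinForm ℝ V) {σ : V → ℝ} {w : V}
    (hw : ∀ v, g w v = σ v) :
    |S w w| ≤ (∑ i, ∑ j, |((toMatrix b g)⁻¹ * toMatrix b S * (toMatrix b g)⁻¹) i j|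
      * (√(toMatrix b g i i) * √(toMatrix b g j j))) * g w w := by
  have hσ : ∀ i, |σ (b i)| ≤ √(toMatrix b g i i) * √(g w w) := by
    intro i
    rw [← hw, ← Real.sqrt_mul (by rw [LinearMap.BilinForm.toMatrix_apply]; exact hg.nonneg _),
      ← Real.sqrt_sq_eq_abs, mul_comm, LinearMap.BilinForm.toMatrix_apply]
    exact Real.sqrt_le_sqrt (hg.apply_sq_le w (b i))
  rw [hg.apply_dual_dual b S hw hw, Finset.sum_mul]
  refine (Finset.abs_sum_le_sum_abs _ _).trans (Finset.sum_le_sum fun i _ => ?_)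
  rw [Finset.sum_mul]
  refine (Finset.abs_sum_le_sum_abs _ _).trans (Finset.sum_le_sum fun j _ => ?_)
  rw [abs_mul, abs_mul, mul_assoc |_|, mul_assoc |_|]
  refine mul_le_mul_of_nonneg_left ?_ (abs_nonneg _)
  calc |σ (b i)| * |σ (b j)|
      ≤ (√(toMatrix b g i i) * √(g w w)) * (√(toMatrix b g j j) * √(g w w)) :=
        mul_le_mul (hσ i) (hσ j) (abs_nonneg _) (by positivity)
    _ = √(toMatrix b g i i) * √(toMatrix b g j j) * (√(g w w) * √(g w w)) := by ring
    _ = _ := by rw [Real.mul_self_sqrt (hg.nonneg w)]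

end IsInner

/-- The trace of one bilinear form with respect to another does not depend on the basis. -/
theorem trace_inv_mul_toMatrix_eq (b b' : Basis (Fin m) ℝ V) (g S : LinearMap.BilinForm ℝ V) :
    ((toMatrix b g)⁻¹ * toMatrix b S).trace = ((toMatrix b' g)⁻¹ * toMatrix b' S).trace := by
  set P := b.toMatrix b' with hP
  have hu : IsUnit P.det :=
    (Matrix.isUnit_iff_isUnit_det P).1 (IsUnit.of_mul_eq_one _ (b.toMatrix_mul_toMatrix_flip b'))
  have hu' : IsUnit Pᵀ.det := by rwa [Matrix.det_transpose]
  rw [← toMatrix_mul_basis_toMatrix b b' g, ← toMatrix_mul_basis_toMatrix b b' S, ← hP,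
    Matrix.mul_inv_rev, Matrix.mul_inv_rev]
  have : P⁻¹ * ((toMatrix b g)⁻¹ * Pᵀ⁻¹) * (Pᵀ * toMatrix b S * P)
      = P⁻¹ * ((toMatrix b g)⁻¹ * toMatrix b S * P) := by
    simp only [mul_assoc]
    rw [← mul_assoc Pᵀ⁻¹, Matrix.nonsing_inv_mul _ hu', one_mul]
  rw [this, Matrix.trace_mul_comm P⁻¹, mul_assoc, Matrix.mul_nonsing_inv _ hu, mul_one]

theorem det_toMatrix_basis_change (b b' : Basis (Fin m) ℝ V) (g : LinearMap.BilinForm ℝ V) :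
    (toMatrix b' g).det = (b.toMatrix b').det ^ 2 * (toMatrix b g).det := by
  rw [← toMatrix_mul_basis_toMatrix b b' g, Matrix.det_mul, Matrix.det_mul, Matrix.det_transpose]
  ring

theorem det_toMatrix_basis_ne_zero (b b' : Basis (Fin m) ℝ V) : (b.toMatrix b').det ≠ 0 :=
  ((Matrix.isUnit_iff_isUnit_det _).1
    (IsUnit.of_mul_eq_one _ (b.toMatrix_mul_toMatrix_flip b'))).ne_zero

end LinearAlgebra

/-! ### Metric, gradients and `𝒮` in bases of the tangent spaces -/

section Tangent

open Module LinearMap.BilinForm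

variable {m : ℕ} {M : Type*} [TopologicalSpace M] [ChartedSpace (EuclideanSpace ℝ (Fin m)) M]

/-- The vectors `frameVec x i` as a basis of `T_x M`. -/
def frameBasis (x : M) : Basis (Fin m) ℝ (TangentSpace (𝓡 m) x) :=
  (EuclideanSpace.basisFun (Fin m) ℝ).toBasis

theorem frameBasis_apply (x : M) (i : Fin m) : frameBasis x i = frameVec x i := by
  have : (EuclideanSpace.basisFun (Fin m) ℝ).toBasis i = stdVec m i := by
    simp [stdVec]
  exact this

variable [IsManifold (𝓡 m) ∞ M]

/-- The domain is written as `ℝᵐ` and not as a tangent space of `ℝᵐ`, so that the standard basis can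
be transported. -/
theorem exists_equiv_eq_mfderiv_extChartAt_symm (c : M) {y : EuclideanSpace ℝ (Fin m)}
    (hy : y ∈ (extChartAt (𝓡 m) c).target) :
    ∃ e : EuclideanSpace ℝ (Fin m) ≃L[ℝ] TangentSpace (𝓡 m) ((extChartAt (𝓡 m) c).symm y),
      ∀ v, e v = mfderiv 𝓘(ℝ, EuclideanSpace ℝ (Fin m)) (𝓡 m) (extChartAt (𝓡 m) c).symm y v := by
  have : IsManifold (𝓡 m) 1 M := IsManifold.of_le (n := ∞) (by simp)
  have h := isInvertible_mfderivWithin_extChartAt_symm (I := 𝓡 m) (x := c) hy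
  rw [ModelWithCorners.range_eq_univ, mfderivWithin_univ] at h
  obtain ⟨e, he⟩ := h
  exact ⟨e, fun v => DFunLike.congr_fun he v⟩

/-- The coordinate vector fields of the chart at `c` form a basis of the tangent space at every
point of the chart domain. -/
def coordBasis (c : M) {y : EuclideanSpace ℝ (Fin m)} (hy : y ∈ (extChartAt (𝓡 m) c).target) :
    Basis (Fin m) ℝ (TangentSpace (𝓡 m) ((extChartAt (𝓡 m) c).symm y)) :=
  (EuclideanSpace.basisFun (Fin m) ℝ).toBasis.map
    (Classical.choose (exists_equiv_eq_mfderiv_extChartAt_symm c hy)).toLinearEquiv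

theorem coordBasis_apply (c : M) {y : EuclideanSpace ℝ (Fin m)}
    (hy : y ∈ (extChartAt (𝓡 m) c).target) (i : Fin m) :
    coordBasis c hy i = coordVec c i y := by
  have h := Classical.choose_spec (exists_equiv_eq_mfderiv_extChartAt_symm c hy) (stdVec m i)
  rw [coordVec, ← h, coordBasis, Basis.map_apply]
  have : (EuclideanSpace.basisFun (Fin m) ℝ).toBasis i = stdVec m i := by
    simp [stdVec]
  rw [this]
  rfl

/-- The metric at `x` as a bilinear form. -/
def metricForm (g : Metric m M) (x : M) : LinearMap.BilinForm ℝ (TangentSpace (𝓡 m) x) :=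
  LinearMap.mk₂ ℝ (fun v w => g.inner x v w) (by simp) (by simp) (by simp) (by simp)

theorem isInner_metricForm (g : Metric m M) (x : M) : IsInner (metricForm g x) :=
  ⟨g.symm x, g.pos x⟩

theorem toMatrix_frameBasis (g : Metric m M) (x : M) :
    toMatrix (frameBasis x) (metricForm g x) = frameGram g x := by
  ext i j
  rw [LinearMap.BilinForm.toMatrix_apply, frameBasis_apply, frameBasis_apply]
  rfl

theorem toMatrix_coordBasis (g : Metric m M) (c : M) {y : EuclideanSpace ℝ (Fin m)}
    (hy : y ∈ (extChartAt (𝓡 m) c).target) :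
    toMatrix (coordBasis c hy) (metricForm g ((extChartAt (𝓡 m) c).symm y)) = gram g c y := by
  ext i j
  rw [LinearMap.BilinForm.toMatrix_apply, coordBasis_apply, coordBasis_apply]
  rfl

theorem det_frameGram_pos (g : Metric m M) (x : M) : 0 < (frameGram g x).det := by
  rw [← toMatrix_frameBasis]
  exact (isInner_metricForm g x).det_pos _

theorem det_gram_pos (g : Metric m M) (c : M) {y : EuclideanSpace ℝ (Fin m)}
    (hy : y ∈ (extChartAt (𝓡 m) c).target) : 0 < (gram g c y).det := by
  rw [← toMatrix_coordBasis g c hy]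
  exact (isInner_metricForm g _).det_pos _

/-- `sharp g x σ` represents the functional `σ`; this characterizes it independently of bases. -/
theorem inner_sharp (g : Metric m M) (x : M) (σ : TangentSpace (𝓡 m) x →L[ℝ] ℝ)
    (v : TangentSpace (𝓡 m) x) : metricForm g x (sharp g x σ) v = σ v := by
  have h : (metricForm g x (sharp g x σ)) = (σ : TangentSpace (𝓡 m) x →ₗ[ℝ] ℝ) := by
    refine (frameBasis x).ext fun k => ?_
    have hk : ∀ i, metricForm g x (frameVec x i) (frameVec x k) = frameGram g x k i := by
      intro i
      rw [(isInner_metricForm g x).symm]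
      rfl
    rw [frameBasis_apply, sharp, map_sum, LinearMap.sum_apply]
    simp only [map_smul, LinearMap.smul_apply, smul_eq_mul, hk, Finset.sum_mul]
    rw [Finset.sum_comm]
    have h1 : ∀ j, ∑ i, (frameGram g x)⁻¹ i j * σ (frameVec x j) * frameGram g x k i
        = (1 : Matrix (Fin m) (Fin m) ℝ) k j * σ (frameVec x j) := by
      intro j
      rw [← Matrix.mul_nonsing_inv _ (det_frameGram_pos g x).ne'.isUnit, Matrix.mul_apply,
        Finset.sum_mul]
      exact Finset.sum_congr rfl fun i _ => by ring
    simp only [h1]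
    simp [Matrix.one_apply]
  rw [h]
  rfl

/-- The inner product `⟨∇f, ∇h⟩` of two gradients, as a function of the differentials. -/
def gradInner (g : Metric m M) (x : M) (σ ζ : TangentSpace (𝓡 m) x →L[ℝ] ℝ) : ℝ :=
  g.inner x (sharp g x σ) (sharp g x ζ)

theorem gradInner_comm (g : Metric m M) (x : M) (σ ζ : TangentSpace (𝓡 m) x →L[ℝ] ℝ) :
    gradInner g x σ ζ = gradInner g x ζ σ := g.symm x _ _

theorem gradInner_self_nonneg (g : Metric m M) (x : M) (σ : TangentSpace (𝓡 m) x →L[ℝ] ℝ) :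
    0 ≤ gradInner g x σ σ := (isInner_metricForm g x).nonneg _

theorem gradInner_sq_le (g : Metric m M) (x : M) (σ ζ : TangentSpace (𝓡 m) x →L[ℝ] ℝ) :
    gradInner g x σ ζ ^ 2 ≤ gradInner g x σ σ * gradInner g x ζ ζ :=
  (isInner_metricForm g x).apply_sq_le _ _

theorem eq_zero_of_gradInner_self_eq_zero (g : Metric m M) (x : M)
    (σ : TangentSpace (𝓡 m) x →L[ℝ] ℝ) (h : gradInner g x σ σ = 0) : σ = 0 := by
  have h0 : sharp g x σ = 0 := by
    by_contra hne
    exact (g.pos x _ hne).ne' h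
  ext v
  rw [← inner_sharp g x σ v, h0]
  simp

/-- Powers of `|∇f|` in terms of `|∇f|²`, which is differentiable in time. -/
theorem gradNorm_rpow (g : Metric m M) (x : M) (σ : TangentSpace (𝓡 m) x →L[ℝ] ℝ) (r : ℝ) :
    gradNorm g x σ ^ r = gradInner g x σ σ ^ (r / 2) := by
  change √(gradInner g x σ σ) ^ r = _
  rw [Real.sqrt_eq_rpow, ← Real.rpow_mul (gradInner_self_nonneg g x σ)]
  congr 1
  ring

theorem gradInner_eq_frame (g : Metric m M) (x : M) (σ ζ : TangentSpace (𝓡 m) x →L[ℝ] ℝ) :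
    gradInner g x σ ζ
      = ∑ i, ∑ j, (frameGram g x)⁻¹ i j * σ (frameVec x i) * ζ (frameVec x j) := by
  have h := (isInner_metricForm g x).inner_dual_dual (frameBasis x) (inner_sharp g x σ)
    (inner_sharp g x ζ)
  simp only [toMatrix_frameBasis, frameBasis_apply] at h
  exact h

theorem gradInner_eq_coord (g : Metric m M) (c : M) {y : EuclideanSpace ℝ (Fin m)}
    (hy : y ∈ (extChartAt (𝓡 m) c).target)
    (σ ζ : TangentSpace (𝓡 m) ((extChartAt (𝓡 m) c).symm y) →L[ℝ] ℝ) :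
    gradInner g _ σ ζ
      = ∑ i, ∑ j, (gram g c y)⁻¹ i j * σ (coordVec c i y) * ζ (coordVec c j y) := by
  have h := (isInner_metricForm g _).inner_dual_dual (coordBasis c hy) (inner_sharp g _ σ)
    (inner_sharp g _ ζ)
  simp only [toMatrix_coordBasis, coordBasis_apply] at h
  exact h

section Tensor

variable {n : ℕ} {N : Type*} [TopologicalSpace N] [ChartedSpace (EuclideanSpace ℝ (Fin n)) N]
  [IsManifold (𝓡 n) ∞ N] (κ : ℝ) (g : Metric m M) (γ : Metric n N) (φ : M → N)

/-- The tensor `𝒮` at `x` as a bilinear form. -/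
def tensorForm (x : M) : LinearMap.BilinForm ℝ (TangentSpace (𝓡 m) x) :=
  LinearMap.mk₂ ℝ (tensorS κ g γ φ x)
    (fun v v' w => by
      simp only [tensorS, ricci, pullback, comp, map_add, _root_.add_apply,
        PiLp.add_apply, mul_add, add_mul, Finset.sum_add_distrib]
      ring)
    (fun a v w => by
      simp only [tensorS, ricci, pullback, comp, map_smul, _root_.smul_apply,
        PiLp.smul_apply, smul_eq_mul, mul_sub, Finset.mul_sum]
      congr 1
      · exact Finset.sum_congr rfl fun i _ => Finset.sum_congr rfl fun j _ => by ring
      · ring)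
    (fun v w w' => by
      simp only [tensorS, ricci, pullback, comp, map_add,
        PiLp.add_apply, mul_add, Finset.sum_add_distrib]
      ring)
    (fun a v w => by
      simp only [tensorS, ricci, pullback, comp, map_smul,
        PiLp.smul_apply, smul_eq_mul, mul_sub, Finset.mul_sum]
      congr 1
      · exact Finset.sum_congr rfl fun i _ => Finset.sum_congr rfl fun j _ => by ring
      · ring)

theorem tensorForm_apply (x : M) (v w : TangentSpace (𝓡 m) x) :
    tensorForm κ g γ φ x v w = tensorS κ g γ φ x v w := rfl

/-- The matrix of `𝒮` in the standard basis of `T_x M`. -/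
def frameTensor (x : M) : Matrix (Fin m) (Fin m) ℝ :=
  Matrix.of fun i j => tensorS κ g γ φ x (frameVec x i) (frameVec x j)

/-- The matrix of `𝒮` in the chart at `c`. -/
def coordTensor (c : M) (y : EuclideanSpace ℝ (Fin m)) : Matrix (Fin m) (Fin m) ℝ :=
  Matrix.of fun i j => tensorS κ g γ φ ((extChartAt (𝓡 m) c).symm y) (coordVec c i y)
    (coordVec c j y)

theorem toMatrix_frameBasis_tensorForm (x : M) :
    toMatrix (frameBasis x) (tensorForm κ g γ φ x) = frameTensor κ g γ φ x := by
  ext i j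
  rw [LinearMap.BilinForm.toMatrix_apply, frameBasis_apply, frameBasis_apply]
  rfl

theorem toMatrix_coordBasis_tensorForm (c : M) {y : EuclideanSpace ℝ (Fin m)}
    (hy : y ∈ (extChartAt (𝓡 m) c).target) :
    toMatrix (coordBasis c hy) (tensorForm κ g γ φ ((extChartAt (𝓡 m) c).symm y))
      = coordTensor κ g γ φ c y := by
  ext i j
  rw [LinearMap.BilinForm.toMatrix_apply, coordBasis_apply, coordBasis_apply]
  rfl

theorem scalarS_eq_trace_frame (x : M) :
    scalarS κ g γ φ x = ((frameGram g x)⁻¹ * frameTensor κ g γ φ x).trace := by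
  have h := (isInner_metricForm g x).sum_inv_mul_eq_trace (frameBasis x) (tensorForm κ g γ φ x)
  rw [toMatrix_frameBasis, toMatrix_frameBasis_tensorForm] at h
  rw [← h]
  simp only [scalarS, metricTrace, frameBasis_apply, tensorForm_apply, tensorS, Finset.mul_sum,
    ← Finset.sum_sub_distrib]
  exact Finset.sum_congr rfl fun i _ => Finset.sum_congr rfl fun j _ => by ring

theorem scalarS_eq_trace_coord (c : M) {y : EuclideanSpace ℝ (Fin m)}
    (hy : y ∈ (extChartAt (𝓡 m) c).target) :
    scalarS κ g γ φ ((extChartAt (𝓡 m) c).symm y)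
      = ((gram g c y)⁻¹ * coordTensor κ g γ φ c y).trace := by
  rw [scalarS_eq_trace_frame, ← toMatrix_frameBasis, ← toMatrix_frameBasis_tensorForm,
    trace_inv_mul_toMatrix_eq _ (coordBasis c hy), toMatrix_coordBasis,
    toMatrix_coordBasis_tensorForm]

theorem tensorS_sharp_frame (x : M) (σ : TangentSpace (𝓡 m) x →L[ℝ] ℝ) :
    tensorS κ g γ φ x (sharp g x σ) (sharp g x σ)
      = ∑ i, ∑ j, ((frameGram g x)⁻¹ * frameTensor κ g γ φ x * (frameGram g x)⁻¹) i j
        * σ (frameVec x i) * σ (frameVec x j) := by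
  have h := (isInner_metricForm g x).apply_dual_dual (frameBasis x) (tensorForm κ g γ φ x)
    (inner_sharp g x σ) (inner_sharp g x σ)
  simp only [toMatrix_frameBasis, toMatrix_frameBasis_tensorForm, frameBasis_apply] at h
  exact h

theorem tensorS_sharp_coord (c : M) {y : EuclideanSpace ℝ (Fin m)}
    (hy : y ∈ (extChartAt (𝓡 m) c).target)
    (σ : TangentSpace (𝓡 m) ((extChartAt (𝓡 m) c).symm y) →L[ℝ] ℝ) :
    tensorS κ g γ φ _ (sharp g _ σ) (sharp g _ σ)
      = ∑ i, ∑ j, ((gram g c y)⁻¹ * coordTensor κ g γ φ c y * (gram g c y)⁻¹) i j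
        * σ (coordVec c i y) * σ (coordVec c j y) := by
  have h := (isInner_metricForm g _).apply_dual_dual (coordBasis c hy) (tensorForm κ g γ φ _)
    (inner_sharp g _ σ) (inner_sharp g _ σ)
  simp only [toMatrix_coordBasis, toMatrix_coordBasis_tensorForm, coordBasis_apply] at h
  exact h

theorem abs_tensorS_sharp_le (c : M) {y : EuclideanSpace ℝ (Fin m)}
    (hy : y ∈ (extChartAt (𝓡 m) c).target)
    (σ : TangentSpace (𝓡 m) ((extChartAt (𝓡 m) c).symm y) →L[ℝ] ℝ) :
    |tensorS κ g γ φ _ (sharp g _ σ) (sharp g _ σ)|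
      ≤ (∑ i, ∑ j, |((gram g c y)⁻¹ * coordTensor κ g γ φ c y * (gram g c y)⁻¹) i j|
        * (√(gram g c y i i) * √(gram g c y j j))) * gradInner g _ σ σ := by
  have h := (isInner_metricForm g _).abs_apply_dual_le (coordBasis c hy) (tensorForm κ g γ φ _)
    (inner_sharp g _ σ)
  simp only [toMatrix_coordBasis, toMatrix_coordBasis_tensorForm] at h
  exact h

end Tensor

end Tangent

/-! ### Regularity in charts and time derivatives along the flow -/

section Charts

variable {m : ℕ} {M : Type*} [TopologicalSpace M] [ChartedSpace (EuclideanSpace ℝ (Fin m)) M]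

/-- Joint continuity in time and space can be checked in charts. -/
theorem continuousOn_of_charts {s : Set ℝ} {F : ℝ → M → ℝ}
    (h : ∀ c : M, ContinuousOn
      (fun z : ℝ × EuclideanSpace ℝ (Fin m) => F z.1 ((extChartAt (𝓡 m) c).symm z.2))
      (s ×ˢ (extChartAt (𝓡 m) c).target)) :
    ContinuousOn (fun z : ℝ × M => F z.1 z.2) (s ×ˢ univ) := by
  rintro ⟨t, x⟩ ⟨ht, -⟩
  have hmaps : MapsTo (fun z : ℝ × M => (z.1, extChartAt (𝓡 m) x z.2))
      (s ×ˢ (extChartAt (𝓡 m) x).source) (s ×ˢ (extChartAt (𝓡 m) x).target) :=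
    fun z hz => ⟨hz.1, (extChartAt (𝓡 m) x).map_source hz.2⟩
  have hc : ContinuousOn (fun z : ℝ × M => (z.1, extChartAt (𝓡 m) x z.2))
      (s ×ˢ (extChartAt (𝓡 m) x).source) :=
    continuousOn_fst.prodMk
      ((continuousOn_extChartAt x).comp continuousOn_snd fun z hz => hz.2)
  have h1 := (h x).comp hc hmaps
  have h2 : ContinuousOn (fun z : ℝ × M => F z.1 z.2) (s ×ˢ (extChartAt (𝓡 m) x).source) := by
    refine h1.congr fun z hz => ?_
    simp only [Function.comp_apply]
    rw [(extChartAt (𝓡 m) x).left_inv hz.2]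
  refine (h2 (t, x) ⟨ht, mem_extChartAt_source x⟩).mono_of_mem_nhdsWithin ?_
  refine mem_nhdsWithin.2 ⟨univ ×ˢ (extChartAt (𝓡 m) x).source,
    isOpen_univ.prod (isOpen_extChartAt_source x), ⟨mem_univ _, mem_extChartAt_source x⟩, ?_⟩
  rintro z ⟨⟨-, hz⟩, hz', -⟩
  exact ⟨hz', hz⟩

/-- Joint continuity gives continuity at a fixed time. -/
theorem continuous_slice {s : Set ℝ} {F : ℝ → M → ℝ}
    (h : ContinuousOn (fun z : ℝ × M => F z.1 z.2) (s ×ˢ univ)) {t : ℝ} (ht : t ∈ s) :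
    Continuous (F t) :=
  h.comp_continuous (f := fun x => (t, x)) (by fun_prop) fun _ => ⟨ht, mem_univ _⟩

variable [IsManifold (𝓡 m) ∞ M]

/-- Chain rule: the differential of `f` on coordinate vectors is given by partial derivatives. -/
theorem mvfderiv_coordVec {f : M → ℝ} (hf : ContMDiff (𝓡 m) 𝓘(ℝ, ℝ) 1 f) (c : M) (i : Fin m)
    {y : EuclideanSpace ℝ (Fin m)} (hy : y ∈ (extChartAt (𝓡 m) c).target) :
    mvfderiv (𝓡 m) f ((extChartAt (𝓡 m) c).symm y) (coordVec c i y)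
      = pd i (fun z => f ((extChartAt (𝓡 m) c).symm z)) y := by
  have : IsManifold (𝓡 m) 1 M := IsManifold.of_le (n := ∞) (by simp)
  have h1 := mdifferentiableWithinAt_extChartAt_symm (I := 𝓡 m) (x := c) hy
  rw [ModelWithCorners.range_eq_univ, mdifferentiableWithinAt_univ] at h1
  have h2 := mvfderiv_comp_apply y ((hf.mdifferentiable one_ne_zero) _) h1 (stdVec m i)
  rw [coordVec, ← h2, pd, ← mfderiv_eq_fderiv]
  rfl

theorem contDiffOn_comp_extChartAt_symm {f : M → ℝ} (hf : ContMDiff (𝓡 m) 𝓘(ℝ, ℝ) 1 f) (c : M) :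
    ContDiffOn ℝ 1 (fun y => f ((extChartAt (𝓡 m) c).symm y)) (extChartAt (𝓡 m) c).target := by
  have : IsManifold (𝓡 m) 1 M := IsManifold.of_le (n := ∞) (by simp)
  rw [← contMDiffOn_iff_contDiffOn]
  exact hf.comp_contMDiffOn (contMDiffOn_extChartAt_symm c)

theorem IsContC1.continuousOn_mvfderiv_coordVec {T : ℝ} {u : ℝ → M → ℝ} (hu : IsContC1 m T u)
    (c : M) (i : Fin m) :
    ContinuousOn (fun z : ℝ × EuclideanSpace ℝ (Fin m) =>
      mvfderiv (𝓡 m) (u z.1) ((extChartAt (𝓡 m) c).symm z.2) (coordVec c i z.2))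
      (Ico 0 T ×ˢ (extChartAt (𝓡 m) c).target) :=
  (hu.continuous_diff c i).congr fun z hz => mvfderiv_coordVec (hu.contMDiff z.1 hz.1) c i hz.2

end Charts

section FlowRegularity

variable {m : ℕ} {M : Type*} [TopologicalSpace M] [ChartedSpace (EuclideanSpace ℝ (Fin m)) M]
  [IsManifold (𝓡 m) ∞ M]
  {n : ℕ} {N : Type*} [TopologicalSpace N] [ChartedSpace (EuclideanSpace ℝ (Fin n)) N]
  [IsManifold (𝓡 n) ∞ N] {κ T : ℝ} {γ : Metric n N} {g : ℝ → Metric m M} {φ : ℝ → M → N}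

/-- The ratio of the Riemannian volume densities of two metrics. -/
def volRatio (g₀ g : Metric m M) (x : M) : ℝ :=
  √((frameGram g x).det / (frameGram g₀ x).det)

theorem volRatio_self (g : Metric m M) (x : M) : volRatio g g x = 1 := by
  rw [volRatio, div_self (det_frameGram_pos g x).ne', Real.sqrt_one]

theorem volRatio_eq_coord (g₀ g : Metric m M) (c : M) {y : EuclideanSpace ℝ (Fin m)}
    (hy : y ∈ (extChartAt (𝓡 m) c).target) :
    volRatio g₀ g ((extChartAt (𝓡 m) c).symm y)
      = √((gram g c y).det / (gram g₀ c y).det) := by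
  have h := det_toMatrix_basis_ne_zero (frameBasis ((extChartAt (𝓡 m) c).symm y)) (coordBasis c hy)
  rw [volRatio, ← toMatrix_coordBasis g c hy, ← toMatrix_coordBasis g₀ c hy,
    det_toMatrix_basis_change (frameBasis _) (coordBasis c hy),
    det_toMatrix_basis_change (frameBasis _) (coordBasis c hy), toMatrix_frameBasis,
    toMatrix_frameBasis, mul_div_mul_left _ _ (pow_ne_zero 2 h)]

namespace IsSolution

variable (hf : IsSolution κ T γ g φ)

include hf

theorem hasDerivWithinAt_inner {t : ℝ} (ht : t ∈ Ico 0 T) (x : M) (v w : TangentSpace (𝓡 m) x) :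
    HasDerivWithinAt (fun s => (g s).inner x v w) (-2 * tensorS κ (g t) γ (φ t) x v w)
      (Ico 0 T) t :=
  (hf.metric_eq t ht x v w).congr_deriv (by rw [tensorS]; ring)

theorem continuousOn_gram (c : M) (i j : Fin m) :
    ContinuousOn (fun z : ℝ × EuclideanSpace ℝ (Fin m) => gram (g z.1) c z.2 i j)
      (Ico 0 T ×ˢ (extChartAt (𝓡 m) c).target) :=
  (hf.smooth_metric c i j).continuousOn

theorem continuousOn_gram_inv (c : M) (i j : Fin m) :
    ContinuousOn (fun z : ℝ × EuclideanSpace ℝ (Fin m) => (gram (g z.1) c z.2)⁻¹ i j)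
      (Ico 0 T ×ˢ (extChartAt (𝓡 m) c).target) :=
  continuousOn_matrix_inv (hf.continuousOn_gram c) (fun _ hz => (det_gram_pos _ c hz.2).ne') i j

/-- The components of `𝒮` are continuous, because `-2 𝒮` is the time derivative of the metric. -/
theorem continuousOn_coordTensor (c : M) (i j : Fin m) :
    ContinuousOn (fun z : ℝ × EuclideanSpace ℝ (Fin m) =>
      coordTensor κ (g z.1) γ (φ z.1) c z.2 i j)
      (Ico 0 T ×ˢ (extChartAt (𝓡 m) c).target) := by
  have hU : UniqueDiffOn ℝ (Ico 0 T ×ˢ (extChartAt (𝓡 m) c).target) :=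
    (uniqueDiffOn_Ico 0 T).prod (isOpen_extChartAt_target c).uniqueDiffOn
  have h1 := (hf.smooth_metric c i j).continuousOn_fderivWithin hU (by simp)
  have h2 : ContinuousOn (fun z : ℝ × EuclideanSpace ℝ (Fin m) =>
      -(1 / 2) * fderivWithin ℝ
        (fun z : ℝ × EuclideanSpace ℝ (Fin m) => gram (g z.1) c z.2 i j)
        (Ico 0 T ×ˢ (extChartAt (𝓡 m) c).target) z (1, 0))
      (Ico 0 T ×ˢ (extChartAt (𝓡 m) c).target) :=
    continuousOn_const.mul (h1.clm_apply continuousOn_const)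
  refine h2.congr fun z hz => ?_
  have h3 := ((hf.smooth_metric c i j).differentiableOn (by simp) z hz).hasFDerivWithinAt
  have h4 : HasDerivWithinAt (fun s : ℝ => (s, z.2)) ((1, 0) : ℝ × EuclideanSpace ℝ (Fin m))
      (Ico 0 T) z.1 :=
    (hasDerivWithinAt_id _ _).prodMk (hasDerivWithinAt_const _ _ _)
  have h5 := h3.comp_hasDerivWithinAt_of_eq z.1 h4 (fun s hs => ⟨hs, hz.2⟩) rfl
  have h6 := hf.hasDerivWithinAt_inner hz.1 ((extChartAt (𝓡 m) c).symm z.2) (coordVec c i z.2)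
    (coordVec c j z.2)
  have h7 := (uniqueDiffOn_Ico 0 T z.1 hz.1).eq_deriv _ h5 h6
  have h8 : coordTensor κ (g z.1) γ (φ z.1) c z.2 i j = -(1 / 2) * (-2 * tensorS κ (g z.1) γ (φ z.1)
      ((extChartAt (𝓡 m) c).symm z.2) (coordVec c i z.2) (coordVec c j z.2)) := by
    simp only [coordTensor, Matrix.of_apply]
    ring
  exact h8.trans (congrArg (fun a => -(1 / 2) * a) h7.symm)

theorem continuousOn_gradInner {u v : ℝ → M → ℝ} (hu : IsContC1 m T u) (hv : IsContC1 m T v) :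
    ContinuousOn (fun z : ℝ × M => gradInner (g z.1) z.2 (mvfderiv (𝓡 m) (u z.1) z.2)
      (mvfderiv (𝓡 m) (v z.1) z.2)) (Ico 0 T ×ˢ univ) := by
  refine continuousOn_of_charts (m := m) (F := fun t x => gradInner (g t) x (mvfderiv (𝓡 m) (u t) x)
      (mvfderiv (𝓡 m) (v t) x)) fun c => ?_
  have h : ContinuousOn (fun z : ℝ × EuclideanSpace ℝ (Fin m) => ∑ i, ∑ j,
      (gram (g z.1) c z.2)⁻¹ i j
        * mvfderiv (𝓡 m) (u z.1) ((extChartAt (𝓡 m) c).symm z.2) (coordVec c i z.2)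
        * mvfderiv (𝓡 m) (v z.1) ((extChartAt (𝓡 m) c).symm z.2) (coordVec c j z.2))
      (Ico 0 T ×ˢ (extChartAt (𝓡 m) c).target) :=
    continuousOn_finsetSum _ fun i _ => continuousOn_finsetSum _ fun j _ =>
      ((hf.continuousOn_gram_inv c i j).mul (hu.continuousOn_mvfderiv_coordVec c i)).mul
        (hv.continuousOn_mvfderiv_coordVec c j)
  exact h.congr fun z hz => gradInner_eq_coord (g z.1) c hz.2 _ _

theorem continuousOn_inv_mul_coordTensor_mul_inv (c : M) (i j : Fin m) :
    ContinuousOn (fun z : ℝ × EuclideanSpace ℝ (Fin m) =>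
      ((gram (g z.1) c z.2)⁻¹ * coordTensor κ (g z.1) γ (φ z.1) c z.2
        * (gram (g z.1) c z.2)⁻¹) i j)
      (Ico 0 T ×ˢ (extChartAt (𝓡 m) c).target) := by
  simp only [Matrix.mul_apply]
  exact continuousOn_finsetSum _ fun k _ => (continuousOn_finsetSum _ fun l _ =>
    (hf.continuousOn_gram_inv c i l).mul (hf.continuousOn_coordTensor c l k)).mul
      (hf.continuousOn_gram_inv c k j)

theorem continuousOn_tensorS_sharp {u : ℝ → M → ℝ} (hu : IsContC1 m T u) :
    ContinuousOn (fun z : ℝ × M => tensorS κ (g z.1) γ (φ z.1) z.2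
      (sharp (g z.1) z.2 (mvfderiv (𝓡 m) (u z.1) z.2))
      (sharp (g z.1) z.2 (mvfderiv (𝓡 m) (u z.1) z.2))) (Ico 0 T ×ˢ univ) := by
  refine continuousOn_of_charts (m := m) (F := fun t x => tensorS κ (g t) γ (φ t) x
      (sharp (g t) x (mvfderiv (𝓡 m) (u t) x)) (sharp (g t) x (mvfderiv (𝓡 m) (u t) x))) fun c => ?_
  have h : ContinuousOn (fun z : ℝ × EuclideanSpace ℝ (Fin m) => ∑ i, ∑ j,
      ((gram (g z.1) c z.2)⁻¹ * coordTensor κ (g z.1) γ (φ z.1) c z.2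
        * (gram (g z.1) c z.2)⁻¹) i j
        * mvfderiv (𝓡 m) (u z.1) ((extChartAt (𝓡 m) c).symm z.2) (coordVec c i z.2)
        * mvfderiv (𝓡 m) (u z.1) ((extChartAt (𝓡 m) c).symm z.2) (coordVec c j z.2))
      (Ico 0 T ×ˢ (extChartAt (𝓡 m) c).target) :=
    continuousOn_finsetSum _ fun i _ => continuousOn_finsetSum _ fun j _ =>
      ((hf.continuousOn_inv_mul_coordTensor_mul_inv c i j).mul
        (hu.continuousOn_mvfderiv_coordVec c i)).mul (hu.continuousOn_mvfderiv_coordVec c j)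
  exact h.congr fun z hz => tensorS_sharp_coord κ (g z.1) γ (φ z.1) c hz.2 _

theorem continuousOn_scalarS :
    ContinuousOn (fun z : ℝ × M => scalarS κ (g z.1) γ (φ z.1) z.2) (Ico 0 T ×ˢ univ) := by
  refine continuousOn_of_charts (m := m) (F := fun t x => scalarS κ (g t) γ (φ t) x) fun c => ?_
  have h : ContinuousOn (fun z : ℝ × EuclideanSpace ℝ (Fin m) =>
      ((gram (g z.1) c z.2)⁻¹ * coordTensor κ (g z.1) γ (φ z.1) c z.2).trace)
      (Ico 0 T ×ˢ (extChartAt (𝓡 m) c).target) := by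
    simp only [Matrix.trace, Matrix.diag_apply, Matrix.mul_apply]
    exact continuousOn_finsetSum _ fun k _ => continuousOn_finsetSum _ fun l _ =>
      (hf.continuousOn_gram_inv c k l).mul (hf.continuousOn_coordTensor c l k)
  exact h.congr fun z hz => scalarS_eq_trace_coord κ (g z.1) γ (φ z.1) c hz.2

theorem continuousOn_volRatio {t₁ : ℝ} (ht₁ : t₁ ∈ Ico 0 T) :
    ContinuousOn (fun z : ℝ × M => volRatio (g t₁) (g z.1) z.2) (Ico 0 T ×ˢ univ) := by
  refine continuousOn_of_charts (m := m) (F := fun t x => volRatio (g t₁) (g t) x) fun c => ?_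
  have hd : ContinuousOn (fun z : ℝ × EuclideanSpace ℝ (Fin m) => (gram (g z.1) c z.2).det)
      (Ico 0 T ×ˢ (extChartAt (𝓡 m) c).target) := by
    simp only [Matrix.det_apply]
    exact continuousOn_finsetSum _ fun σ _ => (continuousOn_finsetProd _ fun i _ =>
      hf.continuousOn_gram c _ _).const_smul _
  have hd₁ : ContinuousOn (fun z : ℝ × EuclideanSpace ℝ (Fin m) => (gram (g t₁) c z.2).det)
      (Ico 0 T ×ˢ (extChartAt (𝓡 m) c).target) :=
    hd.comp (f := fun z : ℝ × EuclideanSpace ℝ (Fin m) => (t₁, z.2))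
      (by fun_prop) fun z hz => ⟨ht₁, hz.2⟩
  exact (hd.div hd₁ fun _ hz => (det_gram_pos _ c hz.2).ne').sqrt.congr fun z hz =>
    volRatio_eq_coord (g t₁) (g z.1) c hz.2

/-- Near every point of `[0,T) × M`, `|𝒮(∇u,∇u)|` is bounded by a multiple of `|∇u|²`. -/
theorem eventually_abs_tensorS_sharp_le (u : ℝ → M → ℝ) {z₀ : ℝ × M}
    (hz₀ : z₀ ∈ Ico 0 T ×ˢ (univ : Set M)) :
    ∃ C, ∀ᶠ z in 𝓝[Ico 0 T ×ˢ univ] z₀,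
      |tensorS κ (g z.1) γ (φ z.1) z.2 (sharp (g z.1) z.2 (mvfderiv (𝓡 m) (u z.1) z.2))
        (sharp (g z.1) z.2 (mvfderiv (𝓡 m) (u z.1) z.2))|
      ≤ C * gradInner (g z.1) z.2 (mvfderiv (𝓡 m) (u z.1) z.2) (mvfderiv (𝓡 m) (u z.1) z.2) := by
  set c := z₀.2 with hc
  have hK : ContinuousOn (fun z : ℝ × EuclideanSpace ℝ (Fin m) => ∑ i, ∑ j,
      |((gram (g z.1) c z.2)⁻¹ * coordTensor κ (g z.1) γ (φ z.1) c z.2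
        * (gram (g z.1) c z.2)⁻¹) i j| * (√(gram (g z.1) c z.2 i i) * √(gram (g z.1) c z.2 j j)))
      (Ico 0 T ×ˢ (extChartAt (𝓡 m) c).target) :=
    continuousOn_finsetSum _ fun i _ => continuousOn_finsetSum _ fun j _ =>
      (hf.continuousOn_inv_mul_coordTensor_mul_inv c i j).abs.mul
        ((hf.continuousOn_gram c i i).sqrt.mul (hf.continuousOn_gram c j j).sqrt)
  have hmaps : MapsTo (fun z : ℝ × M => (z.1, extChartAt (𝓡 m) c z.2))
      (Ico 0 T ×ˢ (extChartAt (𝓡 m) c).source) (Ico 0 T ×ˢ (extChartAt (𝓡 m) c).target) :=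
    fun z hz => ⟨hz.1, (extChartAt (𝓡 m) c).map_source hz.2⟩
  have hcont : ContinuousOn (fun z : ℝ × M => (z.1, extChartAt (𝓡 m) c z.2))
      (Ico 0 T ×ˢ (extChartAt (𝓡 m) c).source) :=
    continuousOn_fst.prodMk
      ((continuousOn_extChartAt c).comp continuousOn_snd fun z hz => hz.2)
  have hmem : Ico 0 T ×ˢ (extChartAt (𝓡 m) c).source ∈ 𝓝[Ico 0 T ×ˢ univ] z₀ := by
    refine mem_nhdsWithin.2 ⟨univ ×ˢ (extChartAt (𝓡 m) c).source,
      isOpen_univ.prod (isOpen_extChartAt_source c), ⟨mem_univ _, mem_extChartAt_source c⟩, ?_⟩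
    rintro z ⟨⟨-, hz⟩, hz', -⟩
    exact ⟨hz', hz⟩
  have hcw := ((hK.comp hcont hmaps) z₀ ⟨hz₀.1, mem_extChartAt_source c⟩).mono_of_mem_nhdsWithin
    hmem
  obtain ⟨C, hC⟩ := exists_gt ((fun z : ℝ × EuclideanSpace ℝ (Fin m) => ∑ i, ∑ j,
      |((gram (g z.1) c z.2)⁻¹ * coordTensor κ (g z.1) γ (φ z.1) c z.2
        * (gram (g z.1) c z.2)⁻¹) i j| * (√(gram (g z.1) c z.2 i i) * √(gram (g z.1) c z.2 j j)))
      (z₀.1, extChartAt (𝓡 m) c z₀.2))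
  refine ⟨C, ?_⟩
  filter_upwards [hcw.tendsto.eventually_le_const hC, hmem] with z hz hz'
  have h := abs_tensorS_sharp_le κ (g z.1) γ (φ z.1) c ((extChartAt (𝓡 m) c).map_source hz'.2)
    (mvfderiv (𝓡 m) (u z.1) _)
  rw [(extChartAt (𝓡 m) c).left_inv hz'.2] at h
  exact h.trans (mul_le_mul_of_nonneg_right hz (gradInner_self_nonneg _ _ _))

/-- The evolution of powers of `|∇u|²`; an exponent greater than `1/2` is needed where `∇u`
vanishes. -/
theorem hasDerivWithinAt_gradInner_rpow {u u' : ℝ → M → ℝ} {t r : ℝ} (ht : t ∈ Ico 0 T)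
    (hr : 1 / 2 < r) (x : M)
    (hu : ∀ w : TangentSpace (𝓡 m) x, HasDerivWithinAt (fun s => mvfderiv (𝓡 m) (u s) x w)
      (mvfderiv (𝓡 m) (u' t) x w) (Ico 0 T) t) :
    HasDerivWithinAt
      (fun s => gradInner (g s) x (mvfderiv (𝓡 m) (u s) x) (mvfderiv (𝓡 m) (u s) x) ^ r)
      ((2 * tensorS κ (g t) γ (φ t) x (sharp (g t) x (mvfderiv (𝓡 m) (u t) x))
          (sharp (g t) x (mvfderiv (𝓡 m) (u t) x))
        + 2 * gradInner (g t) x (mvfderiv (𝓡 m) (u t) x) (mvfderiv (𝓡 m) (u' t) x)) * r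
        * gradInner (g t) x (mvfderiv (𝓡 m) (u t) x) (mvfderiv (𝓡 m) (u t) x) ^ (r - 1))
      (Ico 0 T) t := by
  have hG : ∀ s ∈ Ico 0 T, ∀ i j, HasDerivWithinAt (fun s => frameGram (g s) x i j)
      (((-2 : ℝ) • frameTensor κ (g s) γ (φ s) x) i j) (Ico 0 T) s :=
    fun s hs i j => hf.hasDerivWithinAt_inner hs x _ _
  have hB := hasDerivWithinAt_matrix_inv (A := fun s => frameGram (g s) x) ht
    (fun i j s hs => (hG s hs i j).continuousWithinAt)
    (fun s _ => (det_frameGram_pos (g s) x).ne') (hG t ht)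
  have h := hasDerivWithinAt_quadratic_rpow hr hB (fun i => hu (frameVec x i)) (fun h0 i => by
    rw [← gradInner_eq_frame] at h0
    rw [eq_zero_of_gradInner_self_eq_zero _ _ _ h0]
    rfl)
  simp only [← gradInner_eq_frame] at h
  refine h.congr_deriv ?_
  congr 2
  rw [tensorS_sharp_frame]
  have h1 := gradInner_eq_frame (g t) x (mvfderiv (𝓡 m) (u t) x) (mvfderiv (𝓡 m) (u' t) x)
  have h2 := gradInner_eq_frame (g t) x (mvfderiv (𝓡 m) (u' t) x) (mvfderiv (𝓡 m) (u t) x)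
  rw [gradInner_comm] at h2
  simp only [Finset.sum_add_distrib, ← h1, ← h2]
  rw [add_assoc, ← two_mul, Finset.mul_sum]
  congr 1
  refine Finset.sum_congr rfl fun i _ => ?_
  rw [Finset.mul_sum]
  refine Finset.sum_congr rfl fun j _ => ?_
  rw [Matrix.mul_smul, Matrix.smul_mul, Matrix.smul_apply, smul_eq_mul]
  ring

/-- The evolution `∂ₜ dμ = -S dμ` of the volume density. -/
theorem hasDerivWithinAt_volRatio {t t₁ : ℝ} (ht : t ∈ Ico 0 T) (x : M) :
    HasDerivWithinAt (fun s => volRatio (g t₁) (g s) x)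
      (-scalarS κ (g t) γ (φ t) x * volRatio (g t₁) (g t) x) (Ico 0 T) t := by
  have hG : ∀ i j, HasDerivWithinAt (fun s => frameGram (g s) x i j)
      (((-2 : ℝ) • frameTensor κ (g t) γ (φ t) x) i j) (Ico 0 T) t :=
    fun i j => hf.hasDerivWithinAt_inner ht x _ _
  have hd : 0 < (frameGram (g t) x).det := det_frameGram_pos (g t) x
  have hd₁ : 0 < (frameGram (g t₁) x).det := det_frameGram_pos (g t₁) x
  have h := (((hasDerivWithinAt_det hG).div_const (frameGram (g t₁) x).det).sqrt
    (div_pos hd hd₁).ne')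
  refine h.congr_deriv ?_
  have hadj : (frameGram (g t) x).adjugate
      = (frameGram (g t) x).det • (frameGram (g t) x)⁻¹ := by
    rw [Matrix.inv_def, smul_smul, Ring.mul_inverse_cancel _ hd.ne'.isUnit, one_smul]
  have hs := Real.mul_self_sqrt (div_pos hd hd₁).le
  have hs0 : √((frameGram (g t) x).det / (frameGram (g t₁) x).det) ≠ 0 :=
    (Real.sqrt_pos.2 (div_pos hd hd₁)).ne'
  rw [scalarS_eq_trace_frame, volRatio, hadj, Matrix.smul_mul, Matrix.mul_smul, Matrix.trace_smul,
    Matrix.trace_smul, div_eq_iff (by positivity)]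
  simp only [smul_eq_mul]
  linear_combination (2 * ((frameGram (g t) x)⁻¹ * frameTensor κ (g t) γ (φ t) x).trace) * hs

end IsSolution

end FlowRegularity

/-! ### Weak differentials and the Riemannian measure -/

section WeakDifferential

variable {m : ℕ} {M : Type*} [TopologicalSpace M] [ChartedSpace (EuclideanSpace ℝ (Fin m)) M]
  [IsManifold (𝓡 m) ∞ M]

/-- The differential of a `C¹` function is its weak differential. -/
theorem hasWeakDifferential_mvfderiv {f : M → ℝ} (hf : ContMDiff (𝓡 m) 𝓘(ℝ, ℝ) 1 f) :
    HasWeakDifferential f (mvfderiv (𝓡 m) f) := by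
  have hc1 := contDiffOn_comp_extChartAt_symm hf
  have hpd : ∀ (c : M) (i : Fin m), ContinuousOn
      (fun y => pd i (fun z => f ((extChartAt (𝓡 m) c).symm z)) y) (extChartAt (𝓡 m) c).target :=
    fun c i => ((hc1 c).continuousOn_fderiv_of_isOpen (isOpen_extChartAt_target c)
      le_rfl).clm_apply continuousOn_const
  refine ⟨fun c => ?_, fun c i => ?_, fun c i η hη hηc hηs => ?_⟩
  · exact (hc1 c).continuousOn.locallyIntegrableOn (isOpen_extChartAt_target c).measurableSet
  · exact ((hpd c i).congr fun y hy => mvfderiv_coordVec hf c i hy).locallyIntegrableOn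
      (isOpen_extChartAt_target c).measurableSet
  · have hη1 : ContDiff ℝ 1 η := hη.of_le (by simp)
    have hpdη : Continuous (pd i η) :=
      (hη1.continuous_fderiv one_ne_zero).clm_apply continuous_const
    have hpds : tsupport (pd i η) ⊆ tsupport η := by
      refine closure_minimal (fun y hy => ?_) (isClosed_tsupport η)
      by_contra hy'
      refine hy ?_
      have : η =ᶠ[𝓝 y] 0 := notMem_tsupport_iff_eventuallyEq.1 hy'
      rw [pd, this.fderiv_eq]
      simp
    have hint : ∀ G k : EuclideanSpace ℝ (Fin m) → ℝ, ContinuousOn G (extChartAt (𝓡 m) c).target →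
        Continuous k → tsupport k ⊆ tsupport η → Integrable fun y => G y * k y := by
      intro G k hG hk hks
      have hs : tsupport (fun y => G y * k y) ⊆ tsupport k := tsupport_mul_subset_right
      refine Continuous.integrable_of_hasCompactSupport ?_ ?_
      · exact (hG.mul hk.continuousOn).continuous_of_tsupport_subset (isOpen_extChartAt_target c)
          (hs.trans (hks.trans hηs))
      · exact hηc.of_isClosed_subset (isClosed_tsupport _) (hs.trans hks)
    have hparts := integral_mul_fderiv_eq_neg_fderiv_mul_of_integrable (μ := volume)
      (f := fun y => f ((extChartAt (𝓡 m) c).symm y)) (g := η) (v := stdVec m i)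
      (hint _ _ (hpd c i) hη1.continuous subset_rfl)
      (hint _ _ (hc1 c).continuousOn hpdη hpds)
      (hint _ _ (hc1 c).continuousOn hη1.continuous subset_rfl)
      (fun y hy => ((hc1 c).differentiableOn one_ne_zero).differentiableAt
        ((isOpen_extChartAt_target c).mem_nhds (hηs hy)))
      (fun y _ => (hη1.differentiable one_ne_zero) y)
    refine hparts.trans (congrArg Neg.neg (integral_congr_ae (Filter.Eventually.of_forall ?_)))
    intro y
    by_cases hy : y ∈ (extChartAt (𝓡 m) c).target
    · simp only
      rw [mvfderiv_coordVec hf c i hy]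
      rfl
    · have : η y = 0 := image_eq_zero_of_notMem_tsupport fun h => hy (hηs h)
      simp [this]

end WeakDifferential

section Compact

open scoped ENNReal

variable {M : Type*} [TopologicalSpace M] [CompactSpace M] [MeasurableSpace M] [BorelSpace M]

theorem memLp_of_continuous {μ : Measure M} [IsFiniteMeasure μ] {f : M → ℝ} (hf : Continuous f)
    (r : ℝ≥0∞) : MemLp f r μ := by
  obtain ⟨C, hC⟩ := isCompact_univ.exists_bound_of_continuousOn hf.continuousOn
  exact MemLp.of_bound hf.aestronglyMeasurable C
    (Filter.Eventually.of_forall fun x => hC x (mem_univ x))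

theorem integrable_of_continuous {μ : Measure M} [IsFiniteMeasure μ] {f : M → ℝ}
    (hf : Continuous f) : Integrable f μ :=
  memLp_one_iff_integrable.1 (memLp_of_continuous hf 1)

end Compact

section Measure

open scoped ENNReal

variable {m : ℕ} {M : Type*} [TopologicalSpace M] [ChartedSpace (EuclideanSpace ℝ (Fin m)) M]
  [IsManifold (𝓡 m) ∞ M] [CompactSpace M] [T2Space M]

theorem tsupport_chartPartition_subset (c : M) :
    tsupport (chartPartition m M c) ⊆ (extChartAt (𝓡 m) c).source := by
  rw [extChartAt_source]
  exact Classical.choose_spec (SmoothPartitionOfUnity.exists_isSubordinate_chartAt_source (𝓡 m) M) c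

/-- By compactness only finitely many charts contribute to the Riemannian measure. -/
theorem finite_chartPartition_ne_zero :
    {c : M | (Function.support (chartPartition m M c)).Nonempty}.Finite :=
  (chartPartition m M).locallyFinite.finite_nonempty_of_compact

/-- The density of the Riemannian measure in the chart at `c`, weighted by the partition of
unity. -/
def chartDensity (g : Metric m M) (c : M) (y : EuclideanSpace ℝ (Fin m)) : ℝ≥0∞ :=
  ENNReal.ofReal (chartPartition m M c ((extChartAt (𝓡 m) c).symm y) * √(gram g c y).det)

theorem continuousOn_chartDensity {g : Metric m M} {c : M}
    (hg : ContinuousOn (fun y => (gram g c y).det) (extChartAt (𝓡 m) c).target) :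
    ContinuousOn (chartDensity g c) (extChartAt (𝓡 m) c).target := by
  have h : Continuous (chartPartition m M c) := (chartPartition m M c).contMDiff.continuous
  exact ENNReal.continuous_ofReal.comp_continuousOn
    ((h.comp_continuousOn (continuousOn_extChartAt_symm c)).mul hg.sqrt)

/-- The density has compact support in the chart domain and is bounded there. -/
theorem lintegral_chartDensity_lt_top {g : Metric m M} {c : M}
    (hg : ContinuousOn (fun y => (gram g c y).det) (extChartAt (𝓡 m) c).target) :
    ∫⁻ y in (extChartAt (𝓡 m) c).target, chartDensity g c y < ⊤ := by
  set K := extChartAt (𝓡 m) c '' tsupport (chartPartition m M c) with hKdef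
  have hK : IsCompact K := (isClosed_tsupport _).isCompact.image_of_continuousOn
    ((continuousOn_extChartAt c).mono (tsupport_chartPartition_subset c))
  have hKt : K ⊆ (extChartAt (𝓡 m) c).target := by
    rintro _ ⟨x, hx, rfl⟩
    exact (extChartAt (𝓡 m) c).map_source (tsupport_chartPartition_subset c hx)
  have h : Continuous (chartPartition m M c) := (chartPartition m M c).contMDiff.continuous
  obtain ⟨C, hC⟩ := hK.exists_bound_of_continuousOn
    (((h.comp_continuousOn (continuousOn_extChartAt_symm c)).mul hg.sqrt).mono hKt)
  have hle : ∀ y ∈ (extChartAt (𝓡 m) c).target,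
      chartDensity g c y ≤ K.indicator (fun _ => ENNReal.ofReal C) y := by
    intro y hy
    by_cases hyK : y ∈ K
    · rw [indicator_of_mem hyK]
      exact ENNReal.ofReal_le_ofReal ((le_abs_self _).trans (hC y hyK))
    · have : chartPartition m M c ((extChartAt (𝓡 m) c).symm y) = 0 :=
        image_eq_zero_of_notMem_tsupport fun hx =>
          hyK ⟨_, hx, (extChartAt (𝓡 m) c).right_inv hy⟩
      rw [chartDensity, this, zero_mul, ENNReal.ofReal_zero]
      exact zero_le
  calc ∫⁻ y in (extChartAt (𝓡 m) c).target, chartDensity g c y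
      ≤ ∫⁻ y in (extChartAt (𝓡 m) c).target, K.indicator (fun _ => ENNReal.ofReal C) y :=
        setLIntegral_mono' (isOpen_extChartAt_target c).measurableSet hle
    _ ≤ ∫⁻ y, K.indicator (fun _ => ENNReal.ofReal C) y := setLIntegral_le_lintegral _ _
    _ = ENNReal.ofReal C * volume K := lintegral_indicator_const hK.measurableSet _
    _ < ⊤ := ENNReal.mul_lt_top ENNReal.ofReal_lt_top hK.measure_lt_top

variable [MeasurableSpace M] [BorelSpace M]

/-- The integral against the Riemannian measure is a sum of integrals in charts. -/
theorem lintegral_volMeasure {g : Metric m M}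
    (hg : ∀ c, ContinuousOn (fun y => (gram g c y).det) (extChartAt (𝓡 m) c).target)
    {f : M → ℝ≥0∞} (hf : Measurable f) :
    ∫⁻ x, f x ∂(volMeasure g) = ∑' c : M, ∫⁻ y in (extChartAt (𝓡 m) c).target,
      chartDensity g c y * f ((extChartAt (𝓡 m) c).symm y) := by
  rw [volMeasure, lintegral_sum_measure]
  refine tsum_congr fun c => ?_
  have ht : MeasurableSet (extChartAt (𝓡 m) c).target := (isOpen_extChartAt_target c).measurableSet
  have hw : AEMeasurable (chartDensity g c) (volume.restrict (extChartAt (𝓡 m) c).target) :=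
    (continuousOn_chartDensity (hg c)).aemeasurable ht
  have hs : AEMeasurable (extChartAt (𝓡 m) c).symm
      (volume.restrict (extChartAt (𝓡 m) c).target) :=
    (continuousOn_extChartAt_symm c).aemeasurable ht
  rw [lintegral_map' hf.aemeasurable (hs.mono_ac (withDensity_absolutelyContinuous _ _))]
  exact lintegral_withDensity_eq_lintegral_mul₀ hw (hf.comp_aemeasurable hs)

theorem isFiniteMeasure_volMeasure {g : Metric m M}
    (hg : ∀ c, ContinuousOn (fun y => (gram g c y).det) (extChartAt (𝓡 m) c).target) :
    IsFiniteMeasure (volMeasure g) := by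
  refine ⟨?_⟩
  rw [← lintegral_one, lintegral_volMeasure hg measurable_const,
    tsum_eq_sum (s := (finite_chartPartition_ne_zero (m := m) (M := M)).toFinset)]
  · refine ENNReal.sum_lt_top.2 fun c _ => ?_
    simpa using lintegral_chartDensity_lt_top (hg c)
  · intro c hc
    have h0 : ∀ x, chartPartition m M c x = 0 := by
      intro x
      by_contra hx
      exact hc ((finite_chartPartition_ne_zero (m := m) (M := M)).mem_toFinset.2 ⟨x, hx⟩)
    simp [chartDensity, h0]

/-- The Riemannian measures of two metrics differ by the density `volRatio`. -/
theorem volMeasure_eq_withDensity {g₀ g : Metric m M}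
    (hg₀ : ∀ c, ContinuousOn (fun y => (gram g₀ c y).det) (extChartAt (𝓡 m) c).target)
    (hg : ∀ c, ContinuousOn (fun y => (gram g c y).det) (extChartAt (𝓡 m) c).target)
    (hJ : Continuous (volRatio g₀ g)) :
    volMeasure g = (volMeasure g₀).withDensity fun x => ENNReal.ofReal (volRatio g₀ g x) := by
  have hJm : Measurable fun x => ENNReal.ofReal (volRatio g₀ g x) :=
    ENNReal.measurable_ofReal.comp hJ.measurable
  ext s hs
  rw [withDensity_apply _ hs, ← lintegral_indicator hs, ← lintegral_indicator_one hs,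
    lintegral_volMeasure hg (measurable_one.indicator hs),
    lintegral_volMeasure hg₀ (hJm.indicator hs)]
  refine tsum_congr fun c => setLIntegral_congr_fun
    (isOpen_extChartAt_target c).measurableSet fun y hy => ?_
  have hdens : chartDensity g c y
      = chartDensity g₀ c y * ENNReal.ofReal (volRatio g₀ g ((extChartAt (𝓡 m) c).symm y)) := by
    have h0 := det_gram_pos g₀ c hy
    rw [chartDensity, chartDensity, ← ENNReal.ofReal_mul (mul_nonneg
      ((chartPartition m M).nonneg c _) (Real.sqrt_nonneg _)), volRatio_eq_coord g₀ g c hy,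
      mul_assoc, ← Real.sqrt_mul h0.le, mul_div_cancel₀ _ h0.ne']
  by_cases hx : (extChartAt (𝓡 m) c).symm y ∈ s
  · rw [indicator_of_mem hx, indicator_of_mem hx, hdens, Pi.one_apply, mul_one]
  · rw [indicator_of_notMem hx, indicator_of_notMem hx, mul_zero, mul_zero]

theorem integral_volMeasure_eq {g₀ g : Metric m M}
    (hg₀ : ∀ c, ContinuousOn (fun y => (gram g₀ c y).det) (extChartAt (𝓡 m) c).target)
    (hg : ∀ c, ContinuousOn (fun y => (gram g c y).det) (extChartAt (𝓡 m) c).target)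
    (hJ : Continuous (volRatio g₀ g)) (f : M → ℝ) :
    ∫ x, f x ∂(volMeasure g) = ∫ x, f x * volRatio g₀ g x ∂(volMeasure g₀) := by
  have hJm : Measurable fun x => ENNReal.ofReal (volRatio g₀ g x) :=
    ENNReal.measurable_ofReal.comp hJ.measurable
  rw [volMeasure_eq_withDensity hg₀ hg hJ, integral_withDensity_eq_integral_toReal_smul hJm
    (Filter.Eventually.of_forall fun _ => ENNReal.ofReal_lt_top)]
  refine integral_congr_ae (Filter.Eventually.of_forall fun x => ?_)
  simp only [smul_eq_mul]
  rw [ENNReal.toReal_ofReal (show 0 ≤ volRatio g₀ g x from Real.sqrt_nonneg _), mul_comm]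

end Measure

/-! ### Variation of the integrals -/

section Variation

open Filter

variable {m : ℕ} {M : Type*} [TopologicalSpace M] [ChartedSpace (EuclideanSpace ℝ (Fin m)) M]
  [IsManifold (𝓡 m) ∞ M] [CompactSpace M] [T2Space M] [MeasurableSpace M] [BorelSpace M]
  {n : ℕ} {N : Type*} [TopologicalSpace N] [ChartedSpace (EuclideanSpace ℝ (Fin n)) N]
  [IsManifold (𝓡 n) ∞ N] {κ T : ℝ} {γ : Metric n N} {g : ℝ → Metric m M} {φ : ℝ → M → N}

theorem eventually_le_of_continuousOn {X : Type*} [TopologicalSpace X] {s : Set X} {F : X → ℝ}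
    (hF : ContinuousOn F s) {x : X} (hx : x ∈ s) : ∃ C, ∀ᶠ y in 𝓝[s] x, F y ≤ C :=
  ⟨F x + 1, (hF x hx).tendsto.eventually_le_const (lt_add_one _)⟩

/-- Valid also for `Q = 0`, where `Q ^ (p / 2 - 1)` may be a negative power of `0`. -/
theorem mul_rpow_half_sub_one {Q : ℝ} (hQ : 0 ≤ Q) {p : ℝ} (hp : 1 < p) :
    Q * Q ^ (p / 2 - 1) = Q ^ (p / 2) := by
  rcases hQ.eq_or_lt with rfl | h
  · rw [zero_mul, Real.zero_rpow (by linarith)]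
  · nth_rewrite 1 [← Real.rpow_one Q]
    rw [← Real.rpow_add h]
    congr 1
    ring

theorem sqrt_mul_rpow_half_sub_one {Q : ℝ} (hQ : 0 ≤ Q) {p : ℝ} (hp : 1 < p) :
    √Q * Q ^ (p / 2 - 1) = Q ^ ((p - 1) / 2) := by
  rcases hQ.eq_or_lt with rfl | h
  · rw [Real.sqrt_zero, zero_mul, Real.zero_rpow (by linarith)]
  · rw [Real.sqrt_eq_rpow, ← Real.rpow_add h]
    congr 1
    ring

namespace IsSolution

variable (hf : IsSolution κ T γ g φ)

include hf

omit [CompactSpace M] [T2Space M] [MeasurableSpace M] [BorelSpace M] in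
theorem continuousOn_det_gram {t : ℝ} (ht : t ∈ Ico 0 T) (c : M) :
    ContinuousOn (fun y => (gram (g t) c y).det) (extChartAt (𝓡 m) c).target := by
  have hg : ∀ i j, ContinuousOn (fun y => gram (g t) c y i j) (extChartAt (𝓡 m) c).target :=
    fun i j => (hf.continuousOn_gram c i j).comp (f := fun y => (t, y)) (by fun_prop)
      fun y hy => ⟨ht, hy⟩
  simp only [Matrix.det_apply]
  exact continuousOn_finsetSum _ fun σ _ =>
    (continuousOn_finsetProd _ fun i _ => hg _ _).const_smul _

theorem isFiniteMeasure {t : ℝ} (ht : t ∈ Ico 0 T) : IsFiniteMeasure (volMeasure (g t)) :=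
  isFiniteMeasure_volMeasure (hf.continuousOn_det_gram ht)

/-- The derivative of the integral of a time-dependent function against the evolving Riemannian
measure. -/
theorem hasDerivWithinAt_integral {F F' : ℝ → M → ℝ} {t₁ : ℝ} (ht₁ : t₁ ∈ Ico 0 T)
    (hF : ContinuousOn (fun z : ℝ × M => F z.1 z.2) (Ico 0 T ×ˢ univ))
    (hd : ∀ t ∈ Ico 0 T, ∀ x, HasDerivWithinAt (fun s => F s x) (F' t x) (Ico 0 T) t)
    (hb : ∀ z₀ ∈ Ico 0 T ×ˢ (univ : Set M),
      ∃ C, ∀ᶠ z : ℝ × M in 𝓝[Ico 0 T ×ˢ univ] z₀, |F' z.1 z.2| ≤ C) :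
    HasDerivWithinAt (fun t => ∫ x, F t x ∂(volMeasure (g t)))
      (∫ x, (F' t₁ x - scalarS κ (g t₁) γ (φ t₁) x * F t₁ x) ∂(volMeasure (g t₁)))
      (Ico 0 T) t₁ := by
  have hfin := hf.isFiniteMeasure ht₁
  have hJ := hf.continuousOn_volRatio ht₁
  have hS := hf.continuousOn_scalarS
  -- bounds are uniform only on compact time intervals, so the argument is run on `[0,b]`
  obtain ⟨b, hb₁, hbT⟩ := exists_between ht₁.2
  have hsub : Icc 0 b ⊆ Ico 0 T := fun t ht => ⟨ht.1, ht.2.trans_lt hbT⟩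
  have hsub' : Icc 0 b ×ˢ (univ : Set M) ⊆ Ico 0 T ×ˢ univ := prod_mono hsub subset_rfl
  have hK : IsCompact (Icc 0 b ×ˢ (univ : Set M)) := isCompact_Icc.prod isCompact_univ
  obtain ⟨C₁, hC₁⟩ := exists_bound_of_locally_bounded hK
    (F := fun z : ℝ × M => |F' z.1 z.2|) fun z hz => by
      obtain ⟨C, hC⟩ := hb z (hsub' hz)
      exact ⟨C, hC.filter_mono (nhdsWithin_mono _ hsub')⟩
  obtain ⟨C₂, hC₂⟩ := hK.exists_bound_of_continuousOn (hJ.mono hsub')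
  obtain ⟨C₃, hC₃⟩ := hK.exists_bound_of_continuousOn ((hF.mul (hS.neg.mul hJ)).mono hsub')
  have hmem : Icc 0 b ∈ 𝓝[Ico 0 T] t₁ := by
    refine mem_nhdsWithin.2 ⟨Iio b, isOpen_Iio, hb₁, ?_⟩
    rintro t ⟨htb, ht⟩
    exact ⟨ht.1, le_of_lt htb⟩
  have hint : ∀ t ∈ Icc 0 b,
      Integrable (fun x => F t x * volRatio (g t₁) (g t) x) (volMeasure (g t₁)) := fun t ht =>
    integrable_of_continuous (continuous_slice (F := fun t x => F t x * volRatio (g t₁) (g t) x)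
      (hF.mul hJ) (hsub ht))
  have hderiv : ∀ t ∈ Icc 0 b, ∀ x, HasDerivWithinAt (fun t => F t x * volRatio (g t₁) (g t) x)
      (F' t x * volRatio (g t₁) (g t) x
        + F t x * (-scalarS κ (g t) γ (φ t) x * volRatio (g t₁) (g t) x)) (Icc 0 b) t :=
    fun t ht x =>
      ((hd t (hsub ht) x).fun_mul (hf.hasDerivWithinAt_volRatio (hsub ht) x)).mono hsub
  have hbound : ∀ t ∈ Icc 0 b, ∀ x, |F' t x * volRatio (g t₁) (g t) x
      + F t x * (-scalarS κ (g t) γ (φ t) x * volRatio (g t₁) (g t) x)| ≤ C₁ * C₂ + C₃ := by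
    intro t ht x
    have h1 : |F' t x| ≤ C₁ := hC₁ (t, x) ⟨ht, mem_univ x⟩
    have h2 : |volRatio (g t₁) (g t) x| ≤ C₂ := hC₂ (t, x) ⟨ht, mem_univ x⟩
    have h3 : |F t x * (-scalarS κ (g t) γ (φ t) x * volRatio (g t₁) (g t) x)| ≤ C₃ :=
      hC₃ (t, x) ⟨ht, mem_univ x⟩
    refine (abs_add_le _ _).trans (add_le_add ?_ h3)
    rw [abs_mul]
    exact mul_le_mul h1 h2 (abs_nonneg _) ((abs_nonneg _).trans h1)
  have key := hasDerivWithinAt_integral_of_bound (convex_Icc 0 b)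
    (show t₁ ∈ Icc 0 b from ⟨ht₁.1, hb₁.le⟩) hint hderiv hbound
  have heq : ∀ t ∈ Ico 0 T, ∫ x, F t x ∂(volMeasure (g t))
      = ∫ x, F t x * volRatio (g t₁) (g t) x ∂(volMeasure (g t₁)) := fun t ht =>
    integral_volMeasure_eq (hf.continuousOn_det_gram ht₁) (hf.continuousOn_det_gram ht)
      (continuous_slice (F := fun t x => volRatio (g t₁) (g t) x) hJ ht) _
  have key' := (key.mono_of_mem_nhdsWithin hmem).congr_of_mem heq ht₁
  refine key'.congr_deriv (integral_congr_ae (Eventually.of_forall fun x => ?_))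
  simp only [volRatio_self]
  ring

omit [CompactSpace M] [T2Space M] [MeasurableSpace M] [BorelSpace M] in
/-- `|𝒮(∇u,∇u)| |∇u|^(p-2)` is locally bounded even if `p < 2`, being at most `C |∇u|^p`. -/
theorem locally_bounded_tensorS_mul_rpow {u : ℝ → M → ℝ} (hu : IsContC1 m T u) {p : ℝ}
    (hp : 1 < p) {z₀ : ℝ × M} (hz₀ : z₀ ∈ Ico 0 T ×ˢ (univ : Set M)) :
    ∃ C, ∀ᶠ z : ℝ × M in 𝓝[Ico 0 T ×ˢ univ] z₀,
      |tensorS κ (g z.1) γ (φ z.1) z.2 (sharp (g z.1) z.2 (mvfderiv (𝓡 m) (u z.1) z.2))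
          (sharp (g z.1) z.2 (mvfderiv (𝓡 m) (u z.1) z.2))
        * gradInner (g z.1) z.2 (mvfderiv (𝓡 m) (u z.1) z.2) (mvfderiv (𝓡 m) (u z.1) z.2)
          ^ (p / 2 - 1)| ≤ C := by
  obtain ⟨C, hC⟩ := hf.eventually_abs_tensorS_sharp_le u hz₀
  have hQ := hf.continuousOn_gradInner hu hu
  obtain ⟨C', hC'⟩ := eventually_le_of_continuousOn
    (continuousOn_const (c := C) |>.mul (hQ.rpow_const fun z _ => Or.inr (by linarith : 0 ≤ p / 2)))
    hz₀
  refine ⟨C', ?_⟩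
  filter_upwards [hC, hC'] with z h1 h2
  have h0 := gradInner_self_nonneg (g z.1) z.2 (mvfderiv (𝓡 m) (u z.1) z.2)
  rw [abs_mul, abs_of_nonneg (Real.rpow_nonneg h0 _)]
  refine (mul_le_mul_of_nonneg_right h1 (Real.rpow_nonneg h0 _)).trans ?_
  rwa [mul_assoc, mul_rpow_half_sub_one h0 hp]

omit [CompactSpace M] [T2Space M] [MeasurableSpace M] [BorelSpace M] in
/-- `|⟨∇u,∇v⟩| |∇u|^(p-2)` is locally bounded even if `p < 2`, being at most `|∇u|^(p-1) |∇v|`. -/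
theorem locally_bounded_gradInner_mul_rpow {u v : ℝ → M → ℝ} (hu : IsContC1 m T u)
    (hv : IsContC1 m T v) {p : ℝ} (hp : 1 < p) {z₀ : ℝ × M}
    (hz₀ : z₀ ∈ Ico 0 T ×ˢ (univ : Set M)) :
    ∃ C, ∀ᶠ z : ℝ × M in 𝓝[Ico 0 T ×ˢ univ] z₀,
      |gradInner (g z.1) z.2 (mvfderiv (𝓡 m) (u z.1) z.2) (mvfderiv (𝓡 m) (v z.1) z.2)
        * gradInner (g z.1) z.2 (mvfderiv (𝓡 m) (u z.1) z.2) (mvfderiv (𝓡 m) (u z.1) z.2)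
          ^ (p / 2 - 1)| ≤ C := by
  have hQ := hf.continuousOn_gradInner hu hu
  have hR := hf.continuousOn_gradInner hv hv
  obtain ⟨C', hC'⟩ := eventually_le_of_continuousOn
    (hR.sqrt.mul (hQ.rpow_const fun z _ => Or.inr (by linarith : 0 ≤ (p - 1) / 2))) hz₀
  refine ⟨C', ?_⟩
  filter_upwards [hC'] with z h2
  have h0 := gradInner_self_nonneg (g z.1) z.2 (mvfderiv (𝓡 m) (u z.1) z.2)
  have hcs := Real.abs_le_sqrt (gradInner_sq_le (g z.1) z.2 (mvfderiv (𝓡 m) (u z.1) z.2)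
    (mvfderiv (𝓡 m) (v z.1) z.2))
  rw [Real.sqrt_mul h0, mul_comm] at hcs
  rw [abs_mul, abs_of_nonneg (Real.rpow_nonneg h0 _)]
  refine (mul_le_mul_of_nonneg_right hcs (Real.rpow_nonneg h0 _)).trans ?_
  rwa [mul_assoc, sqrt_mul_rpow_half_sub_one h0 hp]

/-- Functions that are measurable and locally bounded in time and space are integrable at a fixed
time. -/
theorem integrable_of_locally_bounded {F : ℝ → M → ℝ} {t : ℝ} (ht : t ∈ Ico 0 T)
    (hm : Measurable (F t))
    (hb : ∀ z₀ ∈ Ico 0 T ×ˢ (univ : Set M),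
      ∃ C, ∀ᶠ z : ℝ × M in 𝓝[Ico 0 T ×ˢ univ] z₀, |F z.1 z.2| ≤ C) :
    Integrable (F t) (volMeasure (g t)) := by
  have hfin := hf.isFiniteMeasure ht
  have hsub : ({t} : Set ℝ) ×ˢ (univ : Set M) ⊆ Ico 0 T ×ˢ univ :=
    prod_mono (singleton_subset_iff.2 ht) subset_rfl
  obtain ⟨C, hC⟩ := exists_bound_of_locally_bounded (isCompact_singleton.prod isCompact_univ)
    (F := fun z : ℝ × M => |F z.1 z.2|) fun z hz => by
      obtain ⟨C, hC⟩ := hb z (hsub hz)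
      exact ⟨C, hC.filter_mono (nhdsWithin_mono _ hsub)⟩
  exact Integrable.of_bound hm.aestronglyMeasurable C
    (Eventually.of_forall fun x => hC (t, x) ⟨rfl, mem_univ x⟩)

/-- The variation of the Dirichlet integral `∫ |∇u|^p dμ` along the flow. -/
theorem hasDerivWithinAt_integral_gradNorm_rpow {u u' : ℝ → M → ℝ} {t₁ p : ℝ}
    (ht₁ : t₁ ∈ Ico 0 T) (hp : 1 < p) (hu : IsContC1 m T u) (hu' : IsContC1 m T u')
    (hd : ∀ t ∈ Ico 0 T, ∀ (x : M) (w : TangentSpace (𝓡 m) x),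
      HasDerivWithinAt (fun s => mvfderiv (𝓡 m) (u s) x w) (mvfderiv (𝓡 m) (u' t) x w)
        (Ico 0 T) t) :
    HasDerivWithinAt
      (fun t => ∫ x, gradNorm (g t) x (mvfderiv (𝓡 m) (u t) x) ^ p ∂(volMeasure (g t)))
      (p * ∫ x, tensorS κ (g t₁) γ (φ t₁) x (sharp (g t₁) x (mvfderiv (𝓡 m) (u t₁) x))
          (sharp (g t₁) x (mvfderiv (𝓡 m) (u t₁) x))
          * gradNorm (g t₁) x (mvfderiv (𝓡 m) (u t₁) x) ^ (p - 2) ∂(volMeasure (g t₁))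
        + p * ∫ x, gradNorm (g t₁) x (mvfderiv (𝓡 m) (u t₁) x) ^ (p - 2)
          * (g t₁).inner x (sharp (g t₁) x (mvfderiv (𝓡 m) (u t₁) x))
            (sharp (g t₁) x (mvfderiv (𝓡 m) (u' t₁) x)) ∂(volMeasure (g t₁))
        - ∫ x, gradNorm (g t₁) x (mvfderiv (𝓡 m) (u t₁) x) ^ p * scalarS κ (g t₁) γ (φ t₁) x
          ∂(volMeasure (g t₁))) (Ico 0 T) t₁ := by
  have hfin := hf.isFiniteMeasure ht₁
  have hQ := hf.continuousOn_gradInner hu hu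
  have hQp := hQ.rpow_const fun z _ => Or.inr (by linarith : 0 ≤ p / 2)
  have hS := hf.continuousOn_tensorS_sharp hu
  have hR := hf.continuousOn_gradInner hu hu'
  have h1 : ∀ t x, gradNorm (g t) x (mvfderiv (𝓡 m) (u t) x) ^ p
      = gradInner (g t) x (mvfderiv (𝓡 m) (u t) x) (mvfderiv (𝓡 m) (u t) x) ^ (p / 2) :=
    fun t x => gradNorm_rpow _ _ _ _
  have h2 : ∀ t x, gradNorm (g t) x (mvfderiv (𝓡 m) (u t) x) ^ (p - 2)
      = gradInner (g t) x (mvfderiv (𝓡 m) (u t) x) (mvfderiv (𝓡 m) (u t) x) ^ (p / 2 - 1) := by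
    intro t x
    rw [gradNorm_rpow]
    congr 1
    ring
  have hSb := fun z₀ hz₀ => hf.locally_bounded_tensorS_mul_rpow hu hp (z₀ := z₀) hz₀
  have hRb := fun z₀ hz₀ => hf.locally_bounded_gradInner_mul_rpow hu hu' hp (z₀ := z₀) hz₀
  have key := hf.hasDerivWithinAt_integral
    (F := fun t x => gradInner (g t) x (mvfderiv (𝓡 m) (u t) x) (mvfderiv (𝓡 m) (u t) x) ^ (p / 2))
    ht₁ hQp
    (fun t ht x => hf.hasDerivWithinAt_gradInner_rpow ht (by linarith) x (hd t ht x))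
    (fun z₀ hz₀ => by
      obtain ⟨C, hC⟩ := hSb z₀ hz₀
      obtain ⟨C', hC'⟩ := hRb z₀ hz₀
      refine ⟨p * (C + C'), ?_⟩
      filter_upwards [hC, hC'] with z hz hz'
      have : ∀ a b q : ℝ, (2 * a + 2 * b) * (p / 2) * q = p * (a * q + b * q) := by
        intro a b q
        ring
      rw [this, abs_mul, abs_of_pos (by linarith : 0 < p)]
      exact mul_le_mul_of_nonneg_left ((abs_add_le _ _).trans (add_le_add hz hz')) (by linarith))
  simp only [h1, h2]
  refine key.congr_deriv ?_
  have hcQ := continuous_slice (F := fun t x => gradInner (g t) x (mvfderiv (𝓡 m) (u t) x)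
    (mvfderiv (𝓡 m) (u t) x)) hQ ht₁
  have hcQp := continuous_slice (F := fun t x => gradInner (g t) x (mvfderiv (𝓡 m) (u t) x)
    (mvfderiv (𝓡 m) (u t) x) ^ (p / 2)) hQp ht₁
  have hcT := continuous_slice (F := fun t x => tensorS κ (g t) γ (φ t) x
    (sharp (g t) x (mvfderiv (𝓡 m) (u t) x)) (sharp (g t) x (mvfderiv (𝓡 m) (u t) x))) hS ht₁
  have hcR := continuous_slice (F := fun t x => gradInner (g t) x (mvfderiv (𝓡 m) (u t) x)
    (mvfderiv (𝓡 m) (u' t) x)) hR ht₁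
  have hcS := continuous_slice (F := fun t x => scalarS κ (g t) γ (φ t) x) hf.continuousOn_scalarS
    ht₁
  have i1 := hf.integrable_of_locally_bounded (F := fun t x => tensorS κ (g t) γ (φ t) x
    (sharp (g t) x (mvfderiv (𝓡 m) (u t) x)) (sharp (g t) x (mvfderiv (𝓡 m) (u t) x))
    * gradInner (g t) x (mvfderiv (𝓡 m) (u t) x) (mvfderiv (𝓡 m) (u t) x) ^ (p / 2 - 1)) ht₁
    (hcT.measurable.mul (hcQ.measurable.pow_const _)) hSb
  have i2 := hf.integrable_of_locally_bounded (F := fun t x =>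
    gradInner (g t) x (mvfderiv (𝓡 m) (u t) x) (mvfderiv (𝓡 m) (u' t) x)
    * gradInner (g t) x (mvfderiv (𝓡 m) (u t) x) (mvfderiv (𝓡 m) (u t) x) ^ (p / 2 - 1)) ht₁
    (hcR.measurable.mul (hcQ.measurable.pow_const _)) hRb
  have i3 := integrable_of_continuous (μ := volMeasure (g t₁)) (hcQp.mul hcS)
  rw [← integral_const_mul, ← integral_const_mul, ← integral_add (i1.const_mul p), ← integral_sub]
  · refine integral_congr_ae (Eventually.of_forall fun x => ?_)
    simp only [gradInner]
    ring
  · refine ((i1.const_mul p).add (i2.const_mul p)).congr (Eventually.of_forall fun x => ?_)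
    simp only [Pi.add_apply, gradInner]
    ring
  · exact i3
  · refine (i2.const_mul p).congr (Eventually.of_forall fun x => ?_)
    simp only [gradInner]
    ring

/-- The variation of `B(u,v) = ∫ |u|^α |v|^β u v dμ` along the flow. -/
theorem hasDerivWithinAt_funB {u u' v v' : ℝ → M → ℝ} {t₁ α β : ℝ} (ht₁ : t₁ ∈ Ico 0 T)
    (hα : 0 < α) (hβ : 0 < β)
    (hu : ContinuousOn (fun z : ℝ × M => u z.1 z.2) (Ico 0 T ×ˢ univ))
    (hu' : ContinuousOn (fun z : ℝ × M => u' z.1 z.2) (Ico 0 T ×ˢ univ))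
    (hv : ContinuousOn (fun z : ℝ × M => v z.1 z.2) (Ico 0 T ×ˢ univ))
    (hv' : ContinuousOn (fun z : ℝ × M => v' z.1 z.2) (Ico 0 T ×ˢ univ))
    (hdu : ∀ t ∈ Ico 0 T, ∀ x, HasDerivWithinAt (fun s => u s x) (u' t x) (Ico 0 T) t)
    (hdv : ∀ t ∈ Ico 0 T, ∀ x, HasDerivWithinAt (fun s => v s x) (v' t x) (Ico 0 T) t) :
    HasDerivWithinAt (fun t => funB (g t) α β (u t) (v t))
      ((α + 1) * ∫ x, |u t₁ x| ^ α * |v t₁ x| ^ β * v t₁ x * u' t₁ x ∂(volMeasure (g t₁))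
        + (β + 1) * ∫ x, |u t₁ x| ^ α * |v t₁ x| ^ β * u t₁ x * v' t₁ x ∂(volMeasure (g t₁))
        - ∫ x, scalarS κ (g t₁) γ (φ t₁) x
          * (|u t₁ x| ^ α * |v t₁ x| ^ β * u t₁ x * v t₁ x) ∂(volMeasure (g t₁)))
      (Ico 0 T) t₁ := by
  have hfin := hf.isFiniteMeasure ht₁
  have hua := hu.abs.rpow_const fun z _ => Or.inr hα.le
  have hvb := hv.abs.rpow_const fun z _ => Or.inr hβ.le
  have key := hf.hasDerivWithinAt_integral
    (F := fun t x => |u t x| ^ α * |v t x| ^ β * u t x * v t x)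
    (F' := fun t x => (α + 1) * (|u t x| ^ α * |v t x| ^ β * v t x * u' t x)
      + (β + 1) * (|u t x| ^ α * |v t x| ^ β * u t x * v' t x)) ht₁
    (((hua.mul hvb).mul hu).mul hv)
    (fun t ht x => by
      have h1 := (hasDerivAt_abs_rpow_mul_self hα (u t x)).comp_hasDerivWithinAt t (hdu t ht x)
      have h2 := (hasDerivAt_abs_rpow_mul_self hβ (v t x)).comp_hasDerivWithinAt t (hdv t ht x)
      have h3 := h1.mul h2
      have h4 : (fun s => |u s x| ^ α * |v s x| ^ β * u s x * v s x)
          = ((fun y => |y| ^ α * y) ∘ fun s => u s x)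
            * ((fun y => |y| ^ β * y) ∘ fun s => v s x) := by
        funext s
        simp only [Pi.mul_apply, Function.comp_apply]
        ring
      rw [h4]
      refine h3.congr_deriv ?_
      simp only [Function.comp_apply]
      ring)
    (fun z₀ hz₀ => eventually_le_of_continuousOn (ContinuousOn.abs
      ((continuousOn_const.mul (((hua.mul hvb).mul hv).mul hu')).add
        (continuousOn_const.mul (((hua.mul hvb).mul hu).mul hv')))) hz₀)
  refine key.congr_deriv ?_
  have i1 := integrable_of_continuous (μ := volMeasure (g t₁)) (continuous_slice
    (F := fun t x => |u t x| ^ α * |v t x| ^ β * v t x * u' t x)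
    (((hua.mul hvb).mul hv).mul hu') ht₁)
  have i2 := integrable_of_continuous (μ := volMeasure (g t₁)) (continuous_slice
    (F := fun t x => |u t x| ^ α * |v t x| ^ β * u t x * v' t x)
    (((hua.mul hvb).mul hu).mul hv') ht₁)
  have i3 := integrable_of_continuous (μ := volMeasure (g t₁)) (continuous_slice
    (F := fun t x => scalarS κ (g t) γ (φ t) x * (|u t x| ^ α * |v t x| ^ β * u t x * v t x))
    (hf.continuousOn_scalarS.mul (((hua.mul hvb).mul hu).mul hv)) ht₁)
  have i12 : Integrable (fun x => (α + 1) * (|u t₁ x| ^ α * |v t₁ x| ^ β * v t₁ x * u' t₁ x)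
      + (β + 1) * (|u t₁ x| ^ α * |v t₁ x| ^ β * u t₁ x * v' t₁ x)) (volMeasure (g t₁)) :=
    (i1.const_mul _).add (i2.const_mul _)
  rw [integral_sub i12 i3, integral_add (i1.const_mul _) (i2.const_mul _), integral_const_mul,
    integral_const_mul]

/-- The time derivatives of `u` and `v` are admissible test functions. -/
theorem memSobolev {u : ℝ → M → ℝ} (hu : IsContC1 m T u) {t : ℝ} (ht : t ∈ Ico 0 T) (r : ℝ) :
    MemSobolev (g t) r (u t) (mvfderiv (𝓡 m) (u t)) := by
  have hfin := hf.isFiniteMeasure ht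
  refine ⟨memLp_of_continuous (continuous_slice hu.continuous_fun ht) _, ?_,
    hasWeakDifferential_mvfderiv (hu.contMDiff t ht)⟩
  exact memLp_of_continuous (continuous_slice (F := fun t x => gradNorm (g t) x
    (mvfderiv (𝓡 m) (u t) x)) (hf.continuousOn_gradInner hu hu).sqrt ht) _

end IsSolution

omit [BorelSpace M] in
theorem integral_gradNorm_rpow_eq {g : Metric m M} {p : ℝ} (hp : 1 < p)
    {σ : ∀ x : M, TangentSpace (𝓡 m) x →L[ℝ] ℝ} :
    ∫ x, gradNorm g x (σ x) ^ p ∂(volMeasure g)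
      = ∫ x, gradNorm g x (σ x) ^ (p - 2) * g.inner x (sharp g x (σ x)) (sharp g x (σ x))
        ∂(volMeasure g) := by
  refine integral_congr_ae (Eventually.of_forall fun x => ?_)
  have h := mul_rpow_half_sub_one (gradInner_self_nonneg g x (σ x)) hp
  simp only [gradNorm_rpow]
  rw [← h, mul_comm, show (p - 2) / 2 = p / 2 - 1 by ring]
  rfl

omit [BorelSpace M] in
theorem IsEigenpair.funA_eq {g : Metric m M} {p q α β Λ : ℝ} {u v : M → ℝ} (hp : 1 < p)
    (hq : 1 < q) (hpq : (α + 1) / p + (β + 1) / q = 1)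
    (h : IsEigenpair g p q α β Λ u (mvfderiv (𝓡 m) u) v (mvfderiv (𝓡 m) v)) :
    funA g p q α β u v = Λ := by
  have hB := h.normalized
  have h1 := h.eq_u u _ h.mem_u
  have h2 := h.eq_v v _ h.mem_v
  have h3 : ∫ x, |u x| ^ α * |v x| ^ β * v x * u x ∂(volMeasure g) = 1 := by
    rw [← hB, funB]
    exact integral_congr_ae (Eventually.of_forall fun x => by ring)
  have h4 : ∫ x, |u x| ^ α * |v x| ^ β * u x * v x ∂(volMeasure g) = 1 := hB
  rw [funA, integral_gradNorm_rpow_eq hp, integral_gradNorm_rpow_eq hq, h1, h2, h3, h4, mul_one,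
    ← add_mul, hpq, one_mul]

/-- The variation of the eigenvalue function at an eigenpair. -/
theorem IsSolution.hasDerivWithinAt_funA (hf : IsSolution κ T γ g φ) {p q α β : ℝ} (hp : 1 < p)
    (hq : 1 < q) (hα : 0 < α) (hβ : 0 < β) {u v : ℝ → M → ℝ}
    (huv : IsNormalizedEvolution T α β g u v) {t₁ Λ : ℝ} (ht₁ : t₁ ∈ Ico 0 T)
    (h : IsEigenpair (g t₁) p q α β Λ (u t₁) (mvfderiv (𝓡 m) (u t₁)) (v t₁)
      (mvfderiv (𝓡 m) (v t₁))) :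
    HasDerivWithinAt (fun t => funA (g t) p q α β (u t) (v t))
      (variationRHS κ p q α β Λ (g t₁) γ (φ t₁) (u t₁) (v t₁)) (Ico 0 T) t₁ := by
  obtain ⟨hu, u', hu', hdu, hdu'⟩ := huv.evol_u
  obtain ⟨hv, v', hv', hdv, hdv'⟩ := huv.evol_v
  have hA := ((hf.hasDerivWithinAt_integral_gradNorm_rpow ht₁ hp hu hu' hdu').const_mul
    ((α + 1) / p)).add ((hf.hasDerivWithinAt_integral_gradNorm_rpow ht₁ hq hv hv' hdv').const_mul
    ((β + 1) / q))
  have hB := hf.hasDerivWithinAt_funB ht₁ hα hβ hu.continuous_fun hu'.continuous_fun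
    hv.continuous_fun hv'.continuous_fun hdu hdv
  -- the constraint `B(u,v) = 1` makes the derivative of `B` vanish
  have hB0 := (uniqueDiffOn_Ico 0 T t₁ ht₁).eq_deriv _ hB
    ((hasDerivWithinAt_const t₁ (Ico 0 T) (1 : ℝ)).congr_of_mem huv.normalized ht₁)
  -- the eigenvalue equations, tested with the time derivatives
  have e1 := h.eq_u _ _ (hf.memSobolev hu' ht₁ p)
  have e2 := h.eq_v _ _ (hf.memSobolev hv' ht₁ q)
  refine hA.congr_deriv ?_
  have alg : ∀ r a A X C : ℝ, 1 < r →
      a / r * (r * A + r * X - C) = a * A + a * X - a / r * C := by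
    intro r a A X C hr
    have : r ≠ 0 := by linarith
    field_simp
  rw [variationRHS, e1, e2, alg _ _ _ _ _ hp, alg _ _ _ _ _ hq]
  linear_combination Λ * hB0

end Variation

end RHFlow

end

/-- Variation of the eigenvalue function `λ(u,v,t) = funA (g t) p q α β (u t) (v t)` along the flow
with coupling constant `κ`, at a time `t₁` where `(u(t₁), v(t₁))` is a pair of eigenfunctions: for
an arbitrary eigenvalue `Λ`, and in particular for the first eigenvalue. The derivative is taken
within `[0,T)`, so it is two-sided if `t₁ > 0` and one-sided if `t₁ = 0`. -/
theorem proposition3p4 {m n : ℕ}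
    {M : Type*} [TopologicalSpace M] [ChartedSpace (EuclideanSpace ℝ (Fin m)) M]
    [IsManifold (𝓡 m) ∞ M] [CompactSpace M] [T2Space M] [MeasurableSpace M] [BorelSpace M]
    {N : Type*} [TopologicalSpace N] [ChartedSpace (EuclideanSpace ℝ (Fin n)) N]
    [IsManifold (𝓡 n) ∞ N] [CompactSpace N] [T2Space N]
    (γ : RHFlow.Metric n N) (g : ℝ → RHFlow.Metric m M) (φ : ℝ → M → N)
    (κ T p q α β : ℝ) (hκ : 0 < κ) (hp : 1 < p) (hq : 1 < q) (hα : 0 < α) (hβ : 0 < β)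
    (hpq : (α + 1) / p + (β + 1) / q = 1)
    (hflow : RHFlow.IsSolution κ T γ g φ)
    (u v : ℝ → M → ℝ) (huv : RHFlow.IsNormalizedEvolution T α β g u v)
    (t₁ : ℝ) (ht₁ : t₁ ∈ Set.Ico 0 T) :
    (∀ Λ : ℝ, RHFlow.IsEigenpair (g t₁) p q α β Λ
        (u t₁) (mvfderiv (𝓡 m) (u t₁)) (v t₁) (mvfderiv (𝓡 m) (v t₁)) →
      RHFlow.funA (g t₁) p q α β (u t₁) (v t₁) = Λ ∧
      HasDerivWithinAt (fun t => RHFlow.funA (g t) p q α β (u t) (v t))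
        (RHFlow.variationRHS κ p q α β Λ (g t₁) γ (φ t₁) (u t₁) (v t₁)) (Set.Ico 0 T) t₁) ∧
    (RHFlow.IsEigenpair (g t₁) p q α β (RHFlow.firstEigenvalue (g t₁) p q α β)
        (u t₁) (mvfderiv (𝓡 m) (u t₁)) (v t₁) (mvfderiv (𝓡 m) (v t₁)) →
      RHFlow.funA (g t₁) p q α β (u t₁) (v t₁) = RHFlow.firstEigenvalue (g t₁) p q α β ∧
      HasDerivWithinAt (fun t => RHFlow.funA (g t) p q α β (u t) (v t))
        (RHFlow.variationRHS κ p q α β (RHFlow.firstEigenvalue (g t₁) p q α β)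
          (g t₁) γ (φ t₁) (u t₁) (v t₁)) (Set.Ico 0 T) t₁) := by
  have main : ∀ Λ : ℝ, RHFlow.IsEigenpair (g t₁) p q α β Λ
      (u t₁) (mvfderiv (𝓡 m) (u t₁)) (v t₁) (mvfderiv (𝓡 m) (v t₁)) →
      RHFlow.funA (g t₁) p q α β (u t₁) (v t₁) = Λ ∧
      HasDerivWithinAt (fun t => RHFlow.funA (g t) p q α β (u t) (v t))
        (RHFlow.variationRHS κ p q α β Λ (g t₁) γ (φ t₁) (u t₁) (v t₁)) (Set.Ico 0 T) t₁ :=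
    fun Λ h => ⟨h.funA_eq hp hq hpq, hflow.hasDerivWithinAt_funA hp hq hα hβ huv ht₁ h⟩
  exact ⟨main, main _⟩
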